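/- Let $n\ge 1$, $0<\alpha\le 1$ and $1<p<\infty$. Let $\Phi:(0,\infty)\to(0,\infty)$ be increasing (not necessarily strictly) and suppose that, for some constant $D$ with $1\le D<2^n$, $\Phi(2r)\le D\,\Phi(r)$ for all $r>0$. Let $L^{p,\Phi}(\mathbb R^n)$ be the space of all locally integrable functions $f$ (real- or complex-valued) on $\mathbb R^n$ for which there is a finite constant $C\ge 0$ with $\int_{B(x_0,r)}|f(x)|^p\,dx\le C^p\,\Phi(r)$ for all $x_0\in\mathbb R^n$ and $r>0$; the smallest such $C$ is denoted by $\|f\|_{L^{p,\Phi}}$. Let $\mathcal C_\alpha$ be the family of functions $\varphi:\mathbb R^n\to\mathbb R$ supported in $\{|x|\le 1\}$ with $\int_{\mathbb R^n}\varphi(x)\,dx=0$ and $|\varphi(x)-\varphi(x')|\le|x-x'|^\alpha$ for all $x,x'\in\mathbb R^n$; put $\varphi_t(x)=t^{-n}\varphi(x/t)$ for $t>0$. For locally integrable $f$ define $$A_\alpha(f)(x,t)=\sup_{\varphi\in\mathcal C_\alpha}\Big|\int_{\mathbb R^n}\varphi_t(x-z)f(z)\,dz\Big|,\qquad g_\alpha(f)(x)=\Big(\int_0^\infty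 A_\alpha(f)(x,t)^2\,\frac{dt}{t}\Big)^{1/2}\in[0,\infty].$$ Then there is a constant $C>0$, independent of $f$, such that for every $f\in L^{p,\Phi}(\mathbb R^n)$ one has $g_\alpha(f)\in L^{p,\Phi}(\mathbb R^n)$ (in particular, $g_\alpha(f)$ is finite almost everywhere) and $$\|g_\alpha(f)\|_{L^{p,\Phi}}\le C\,\|f\|_{L^{p,\Phi}}.$$ -/

import Mathlib

open scoped ENNReal NNReal

noncomputable section

namespace IntrinsicMorrey

/-- A growth function: positive and increasing on `(0, ∞)`, with the doubling condition
`Φ (2 r) ≤ D * Φ r` for all `r > 0`, where `D ≥ 1`. Values of `Φ` outside `(0, ∞)` play no role. -/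
structure IsGrowthFunction (Φ : ℝ → ℝ) (D : ℝ) : Prop where
  pos : ∀ r : ℝ, 0 < r → 0 < Φ r
  mono : MonotoneOn Φ (Set.Ioi 0)
  one_le : 1 ≤ D
  doubling : ∀ r : ℝ, 0 < r → Φ (2 * r) ≤ D * Φ r

/-- The family `𝒞_α`: real functions on `ℝⁿ` supported in the closed unit ball, with mean zero and
`|φ x - φ x'| ≤ |x - x'| ^ α`. -/
structure IsAdmissible {n : ℕ} (α : ℝ) (φ : EuclideanSpace ℝ (Fin n) → ℝ) : Prop where
  support_subset : Function.support φ ⊆ Metric.closedBall 0 1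
  integral_eq_zero : ∫ x, φ x = 0
  holder : ∀ x x' : EuclideanSpace ℝ (Fin n), |φ x - φ x'| ≤ ‖x - x'‖ ^ α

/-- The dilation `φ_t (x) = t⁻ⁿ φ (x / t)`. -/
def dilate {n : ℕ} (φ : EuclideanSpace ℝ (Fin n) → ℝ) (t : ℝ) (x : EuclideanSpace ℝ (Fin n)) : ℝ :=
  (t ^ n)⁻¹ * φ (t⁻¹ • x)

variable {𝕜 : Type*} [RCLike 𝕜] {n : ℕ}

/-- `A_α(f)(y, t) = sup_{φ ∈ 𝒞_α} |∫ φ_t (y - z) f z dz|`, with values in `[0, ∞]`. -/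
def supConv (α : ℝ) (f : EuclideanSpace ℝ (Fin n) → 𝕜) (y : EuclideanSpace ℝ (Fin n)) (t : ℝ) :
    ℝ≥0∞ :=
  ⨆ (φ : EuclideanSpace ℝ (Fin n) → ℝ) (_ : IsAdmissible α φ), ‖∫ z, dilate φ t (y - z) • f z‖ₑ

/-- The intrinsic Littlewood–Paley function `g_α(f)(x) = (∫₀^∞ A_α(f)(x, t)² dt / t) ^ (1/2)`,
with values in `[0, ∞]`. -/
def gFun (α : ℝ) (f : EuclideanSpace ℝ (Fin n) → 𝕜) (x : EuclideanSpace ℝ (Fin n)) : ℝ≥0∞ :=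
  (∫⁻ t in Set.Ioi (0 : ℝ), supConv α f x t ^ (2 : ℕ) / ENNReal.ofReal t) ^ (1 / 2 : ℝ)

/-- The norm of the generalized Morrey space `L^{p,Φ}`: the smallest constant `C ∈ [0, ∞]` with
`∫_{B(x₀, r)} |f|^p ≤ C^p Φ r` for all balls. The target `ε` is `ℝ`, `ℂ`, or `[0, ∞]`. -/
def morreyNorm {ε : Type*} [ENorm ε] (p : ℝ) (Φ : ℝ → ℝ) (f : EuclideanSpace ℝ (Fin n) → ε) :
    ℝ≥0∞ :=
  sInf {C : ℝ≥0∞ | ∀ (x₀ : EuclideanSpace ℝ (Fin n)) (r : ℝ), 0 < r →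
    ∫⁻ x in Metric.ball x₀ r, ‖f x‖ₑ ^ p ≤ C ^ p * ENNReal.ofReal (Φ r)}

/-- Membership in `L^{p,Φ}`: locally integrable with finite norm. -/
def MemMorrey {ε : Type*} [TopologicalSpace ε] [ContinuousENorm ε] (p : ℝ) (Φ : ℝ → ℝ)
    (f : EuclideanSpace ℝ (Fin n) → ε) : Prop :=
  MeasureTheory.LocallyIntegrable f ∧ morreyNorm p Φ f < ∞

end IntrinsicMorrey

end

open scoped ENNReal NNReal

noncomputable section

open MeasureTheory Set Filter Topology

namespace IntrinsicMorrey

/-! Fix a ball B of radius r and split f into its restriction to the double ball 2B and the rest.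

Far part: for x in B and t < r the kernels φ_t(x - ·) are supported in 2B and see nothing. For t ≈
2^j r, Hölder and the Morrey bound on a ball of radius 2^(j+2) r give A_α ≲ ((D/2^n)^j
Φ(r)/r^n)^(1/p), and D < 2^n makes the sum over j geometric (`gSq_far_le`).

Near part: since the p-th power integral of f over 2B is at most D C^p Φ(r), it suffices that g_α is
bounded on L^p (`lintegral_gSq_rpow_le`). One may take f nonnegative and integrable and use dyadic
martingales. By the one-third trick every ball of radius t lies in a cube of comparable side, of
some generation k, in one of 2^n translated grids. Write f = E_k f + Σ_m Δ_{k+m} f, with E_k the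
average over cells and Δ_j = E_{j+1} - E_j. The mean zero of the kernel kills E_k f. On cells of
generation k+m the kernel may be replaced by its difference with its value at one point of the cell,
because functions constant on these cells are orthogonal to Δ_{k+m} f; Hölder continuity then gains
2^(-αm). Hence A_α(f)(x,t) ≲ Σ_m 2^(-αm) E_k|Δ_{k+m} f|(x) uniformly in φ (`enorm_conv_le`). It
remains to bound S_m = (Σ_k (E_k|Δ_{k+m} f|)²)^(1/2) in L^p uniformly in m
(`lintegral_tsum_shiftSq_le`).

This rests on Doob's maximal inequality and on `energy_sum`: for 1 < p ≤ 2 and weights W_k that are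
constant on cells of generation k and increase with k, Σ_k ∫ |Δ_k f|² (E_k f)^(p-2) W_k ≲ ∫ f^p W_N.
It is a second-order convexity bound for u^p at E_k f, valid because doubling of the cells gives
E_{k+1} f ≤ D E_k f. For p ≤ 2, Cauchy–Schwarz splits off powers of E_k f, which the maximal
function controls. For p > 2, one tests S_m² against w = S_m^(p-2), uses the energy bound with
exponent 2 and W_k the maximal function of w, and absorbs. -/

/-- A refining sequence of countable measurable partitions of a measure space into cells of positive
finite measure, such that a cell has at most `D` times the measure of each of its children.
The cells of generation `k` are the fibers of `label k`. -/
structure CellFiltration {X : Type*} [MeasurableSpace X] (μ : Measure X) (ι : Type*)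
    [MeasurableSpace ι] (D : ℝ≥0) where
  label : ℕ → X → ι
  measurable_label : ∀ k, Measurable (label k)
  refines : ∀ k x y, label (k + 1) x = label (k + 1) y → label k x = label k y
  measure_ne_zero : ∀ k x, μ {y | label k y = label k x} ≠ 0
  measure_ne_top : ∀ k x, μ {y | label k y = label k x} ≠ ∞
  doubling : ∀ k x, μ {y | label k y = label k x} ≤ D * μ {y | label (k + 1) y = label (k + 1) x}

/-! ### Averages over the cells of a filtration -/

namespace CellFiltration

variable {X : Type*} [MeasurableSpace X] {μ : Measure X} {ι : Type*} [MeasurableSpace ι] {D : ℝ≥0}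
  (F : CellFiltration μ ι D)

/-- The cell of generation `k` containing `x`. -/
def cell (k : ℕ) (x : X) : Set X := {y | F.label k y = F.label k x}

/-- Averages of nonnegative extended functions over the cells of generation `k`. -/
def lmean (k : ℕ) (u : X → ℝ≥0∞) (x : X) : ℝ≥0∞ := ⨍⁻ y in F.cell k x, u y ∂μ

/-- Averages of real functions over the cells of generation `k`. -/
def mean (k : ℕ) (f : X → ℝ) (x : X) : ℝ := ⨍ y in F.cell k x, f y ∂μ

/-- The martingale difference between generations `k` and `k + 1`. -/
def diff (k : ℕ) (f : X → ℝ) (x : X) : ℝ := F.mean (k + 1) f x - F.mean k f x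

/-- A function is constant on the cells of generation `k`. -/
def IsConst {β : Type*} (k : ℕ) (W : X → β) : Prop :=
  ∀ x y, F.label k x = F.label k y → W x = W y

lemma cell_congr {k : ℕ} {x y : X} (h : F.label k x = F.label k y) : F.cell k x = F.cell k y := by
  simp [cell, h]

lemma label_of_le {j k : ℕ} (hjk : j ≤ k) {x y : X} (h : F.label k x = F.label k y) :
    F.label j x = F.label j y := by
  induction k, hjk using Nat.le_induction with
  | base => exact h
  | succ k _ ih => exact ih (F.refines k x y h)

lemma cell_subset_of_le {j k : ℕ} (hjk : j ≤ k) (x : X) : F.cell k x ⊆ F.cell j x :=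
  fun _ hy => F.label_of_le hjk hy

variable {F} in
lemma IsConst.mono {β : Type*} {j k : ℕ} {W : X → β} (h : F.IsConst j W) (hjk : j ≤ k) :
    F.IsConst k W := fun x y hxy => h x y (F.label_of_le hjk hxy)

lemma isConst_lmean (k : ℕ) (u : X → ℝ≥0∞) : F.IsConst k (F.lmean k u) := fun x y h => by
  simp only [lmean, F.cell_congr h]

lemma isConst_mean (k : ℕ) (f : X → ℝ) : F.IsConst k (F.mean k f) := fun x y h => by
  simp only [mean, F.cell_congr h]

lemma isConst_diff (k : ℕ) (f : X → ℝ) : F.IsConst (k + 1) (F.diff k f) := fun x y h => by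
  simp only [diff, F.isConst_mean (k + 1) f x y h,
    (F.isConst_mean k f).mono (Nat.le_succ k) x y h]

instance isProbabilityMeasure_cell (k : ℕ) (x : X) :
    IsProbabilityMeasure ((μ (F.cell k x))⁻¹ • μ.restrict (F.cell k x)) :=
  ⟨by
    rw [Measure.smul_apply, Measure.restrict_apply_univ, smul_eq_mul]
    exact ENNReal.inv_mul_cancel (F.measure_ne_zero k x) (F.measure_ne_top k x)⟩

lemma lmean_eq (k : ℕ) (u : X → ℝ≥0∞) (x : X) :
    F.lmean k u x = ∫⁻ y, u y ∂((μ (F.cell k x))⁻¹ • μ.restrict (F.cell k x)) := by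
  rw [lmean, setLAverage_eq']

lemma measure_mul_lmean (k : ℕ) (u : X → ℝ≥0∞) (x : X) :
    μ (F.cell k x) * F.lmean k u x = ∫⁻ y in F.cell k x, u y ∂μ :=
  measure_mul_setLAverage _ (F.measure_ne_top k x)

lemma lmean_mono {k : ℕ} {u v : X → ℝ≥0∞} {x : X} (h : ∀ y, u y ≤ v y) :
    F.lmean k u x ≤ F.lmean k v x := by
  simp only [lmean_eq]
  exact lintegral_mono h

/-- Jensen for a concave power, obtained as Hölder against the constant 1 for the normalized measure
on the cell. -/
lemma lmean_rpow_le (k : ℕ) {u : X → ℝ≥0∞} (hu : Measurable u) {s : ℝ} (h0 : 0 ≤ s) (h1 : s ≤ 1)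
    (x : X) : F.lmean k (fun y => u y ^ s) x ≤ F.lmean k u x ^ s := by
  simp only [lmean_eq]
  have := ENNReal.lintegral_mul_norm_pow_le
    (μ := (μ (F.cell k x))⁻¹ • μ.restrict (F.cell k x)) hu.aemeasurable
    (aemeasurable_const (b := (1 : ℝ≥0∞))) h0 (sub_nonneg.2 h1) (by ring)
  simpa only [ENNReal.one_rpow, mul_one, lintegral_one, measure_univ] using this

lemma rpow_lmean_le (k : ℕ) {u : X → ℝ≥0∞} (hu : Measurable u) {q : ℝ} (h1 : 1 ≤ q) (x : X) :
    F.lmean k u x ^ q ≤ F.lmean k (fun y => u y ^ q) x := by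
  have hq : 0 < q := by linarith
  have := F.lmean_rpow_le k (hu.pow_const q) (inv_nonneg.2 hq.le) (inv_le_one_of_one_le₀ h1) x
  simp only [ENNReal.rpow_rpow_inv hq.ne'] at this
  calc _ ≤ ((F.lmean k (fun y => u y ^ q) x) ^ q⁻¹) ^ q := ENNReal.rpow_le_rpow this hq.le
    _ = _ := ENNReal.rpow_inv_rpow hq.ne' _

lemma lmean_mul_rpow_le (k : ℕ) {u v : X → ℝ≥0∞} (hu : Measurable u) (hv : Measurable v) (x : X) :
    F.lmean k (fun y => u y ^ (1 / 2 : ℝ) * v y ^ (1 / 2 : ℝ)) x ≤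
      F.lmean k u x ^ (1 / 2 : ℝ) * F.lmean k v x ^ (1 / 2 : ℝ) := by
  simp only [lmean_eq]
  exact ENNReal.lintegral_mul_norm_pow_le hu.aemeasurable hv.aemeasurable (by norm_num)
    (by norm_num) (by norm_num)

section Countable

lemma measurableSet_cell [MeasurableSingletonClass ι] (k : ℕ) (x : X) :
    MeasurableSet (F.cell k x) :=
  F.measurable_label k (measurableSet_singleton (F.label k x))

lemma setLIntegral_isConst [MeasurableSingletonClass ι] {k : ℕ} {W : X → ℝ≥0∞}
    (hW : F.IsConst k W) (x : X) :
    ∫⁻ y in F.cell k x, W y ∂μ = W x * μ (F.cell k x) := by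
  rw [setLIntegral_congr_fun (F.measurableSet_cell k x) (fun y hy => hW y x hy),
    setLIntegral_const]

lemma setLIntegral_mul_isConst [MeasurableSingletonClass ι] {k : ℕ} {u W : X → ℝ≥0∞}
    (hu : Measurable u)
    (hW : F.IsConst k W) (x : X) :
    ∫⁻ y in F.cell k x, u y * W y ∂μ = (∫⁻ y in F.cell k x, u y ∂μ) * W x := by
  rw [setLIntegral_congr_fun (g := fun y => u y * W x) (F.measurableSet_cell k x)
    (fun y hy => by simp only [hW y x hy]), lintegral_mul_const _ hu]

lemma setLIntegral_lmean [MeasurableSingletonClass ι] (k : ℕ) (u : X → ℝ≥0∞) (x : X) :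
    ∫⁻ y in F.cell k x, F.lmean k u y ∂μ = ∫⁻ y in F.cell k x, u y ∂μ := by
  rw [F.setLIntegral_isConst (F.isConst_lmean k u), mul_comm, measure_mul_lmean]

variable [Countable ι] [MeasurableSingletonClass ι]

variable {F} in
-- There are countably many labels, so any union of cells is measurable, whatever the target space.
lemma IsConst.measurable {β : Type*} [MeasurableSpace β] {k : ℕ} {W : X → β} (h : F.IsConst k W) :
    Measurable W := by
  intro s _
  have : W ⁻¹' s = F.label k ⁻¹' (F.label k '' (W ⁻¹' s)) := by
    ext x
    simp only [mem_preimage, mem_image]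
    exact ⟨fun hx => ⟨x, hx, rfl⟩, fun ⟨y, hy, hxy⟩ => h x y hxy.symm ▸ hy⟩
  rw [this]
  exact F.measurable_label k (Set.to_countable _).measurableSet

lemma measurable_lmean (k : ℕ) (u : X → ℝ≥0∞) : Measurable (F.lmean k u) :=
  (F.isConst_lmean k u).measurable

lemma measurable_mean (k : ℕ) (f : X → ℝ) : Measurable (F.mean k f) :=
  (F.isConst_mean k f).measurable

lemma measurable_diff (k : ℕ) (f : X → ℝ) : Measurable (F.diff k f) :=
  (F.isConst_diff k f).measurable

lemma lintegral_eq_tsum_fibers (k : ℕ) (u : X → ℝ≥0∞) :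
    ∫⁻ x, u x ∂μ = ∑' i, ∫⁻ x in F.label k ⁻¹' {i}, u x ∂μ := by
  rw [← lintegral_iUnion (fun i => F.measurable_label k (measurableSet_singleton i)),
    ← preimage_iUnion, iUnion_of_singleton, preimage_univ, setLIntegral_univ]
  intro i j hij
  exact Disjoint.preimage _ (by simpa using hij)

/-- Integrals can be compared cell by cell. -/
lemma lintegral_le_of_cells (k : ℕ) {u v : X → ℝ≥0∞}
    (h : ∀ x, ∫⁻ y in F.cell k x, u y ∂μ ≤ ∫⁻ y in F.cell k x, v y ∂μ) :
    ∫⁻ x, u x ∂μ ≤ ∫⁻ x, v x ∂μ := by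
  rw [F.lintegral_eq_tsum_fibers k, F.lintegral_eq_tsum_fibers k]
  refine ENNReal.tsum_le_tsum fun i => ?_
  rcases (F.label k ⁻¹' {i}).eq_empty_or_nonempty with he | ⟨x, hx⟩
  · simp [he]
  · have : F.label k ⁻¹' {i} = F.cell k x := by
      ext y; simp only [mem_preimage, mem_singleton_iff, cell, mem_ofPred_eq] at hx ⊢; rw [hx]
    rw [this]; exact h x

lemma lintegral_lmean_mul (k : ℕ) {u W : X → ℝ≥0∞} (hu : Measurable u) (hW : F.IsConst k W) :
    ∫⁻ x, F.lmean k u x * W x ∂μ = ∫⁻ x, u x * W x ∂μ := by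
  have : ∀ x, ∫⁻ y in F.cell k x, F.lmean k u y * W y ∂μ = ∫⁻ y in F.cell k x, u y * W y ∂μ := by
    intro x
    rw [F.setLIntegral_mul_isConst (F.measurable_lmean k u) hW,
      F.setLIntegral_mul_isConst hu hW, setLIntegral_lmean]
  exact le_antisymm (F.lintegral_le_of_cells k fun x => (this x).le)
    (F.lintegral_le_of_cells k fun x => (this x).ge)

lemma lintegral_lmean (k : ℕ) {u : X → ℝ≥0∞} (hu : Measurable u) :
    ∫⁻ x, F.lmean k u x ∂μ = ∫⁻ x, u x ∂μ := by
  simpa using F.lintegral_lmean_mul k (W := fun _ => 1) hu (fun _ _ _ => rfl)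

/-- Averaging over cells is self-adjoint. -/
lemma lintegral_lmean_mul_comm (k : ℕ) {u v : X → ℝ≥0∞} (hu : Measurable u) (hv : Measurable v) :
    ∫⁻ x, F.lmean k u x * v x ∂μ = ∫⁻ x, u x * F.lmean k v x ∂μ := by
  rw [← F.lintegral_lmean_mul k hu (F.isConst_lmean k v)]
  simp only [mul_comm (F.lmean k u _)]
  rw [F.lintegral_lmean_mul k hv (F.isConst_lmean k u)]

lemma lintegral_lmean_rpow_le (k : ℕ) {u : X → ℝ≥0∞} (hu : Measurable u) {q : ℝ} (hq : 1 ≤ q) :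
    ∫⁻ x, F.lmean k u x ^ q ∂μ ≤ ∫⁻ x, u x ^ q ∂μ := by
  rw [← F.lintegral_lmean k (hu.pow_const q)]
  exact lintegral_mono fun x => F.rpow_lmean_le k hu hq x

/-- The martingale property, tested against a weight that does not distinguish the children of a
cell. -/
lemma lintegral_lmean_succ_mul (k : ℕ) {u W : X → ℝ≥0∞} (hu : Measurable u) (hW : F.IsConst k W) :
    ∫⁻ x, F.lmean (k + 1) u x * W x ∂μ = ∫⁻ x, F.lmean k u x * W x ∂μ := by
  rw [F.lintegral_lmean_mul k hu hW, F.lintegral_lmean_mul (k + 1) hu (hW.mono (Nat.le_succ k))]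

end Countable

/-- The maximal function of generation at most `N`. -/
def maxFun (N : ℕ) (u : X → ℝ≥0∞) (x : X) : ℝ≥0∞ := ⨆ k ≤ N, F.lmean k u x

lemma isConst_maxFun (N : ℕ) (u : X → ℝ≥0∞) : F.IsConst N (F.maxFun N u) := fun x y h => by
  simp only [maxFun]
  exact iSup_congr fun k => iSup_congr fun hk => (F.isConst_lmean k u).mono hk x y h

lemma measurable_maxFun [Countable ι] [MeasurableSingletonClass ι] (N : ℕ) (u : X → ℝ≥0∞) :
    Measurable (F.maxFun N u) :=
  (F.isConst_maxFun N u).measurable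

lemma lmean_le_maxFun {k N : ℕ} (hk : k ≤ N) (u : X → ℝ≥0∞) (x : X) :
    F.lmean k u x ≤ F.maxFun N u x := le_iSup₂ (f := fun k (_ : k ≤ N) => F.lmean k u x) k hk

lemma maxFun_mono {M N : ℕ} (h : M ≤ N) (u : X → ℝ≥0∞) (x : X) : F.maxFun M u x ≤ F.maxFun N u x :=
  iSup₂_le fun _ hk => F.lmean_le_maxFun (hk.trans h) u x

lemma maxFun_zero (u : X → ℝ≥0∞) (x : X) : F.maxFun 0 u x = F.lmean 0 u x := by
  simp [maxFun]

lemma maxFun_succ (N : ℕ) (u : X → ℝ≥0∞) (x : X) :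
    F.maxFun (N + 1) u x = max (F.maxFun N u x) (F.lmean (N + 1) u x) := by
  refine le_antisymm (iSup₂_le fun k hk => ?_) (max_le (F.maxFun_mono N.le_succ u x)
    (F.lmean_le_maxFun le_rfl u x))
  rcases Nat.le_succ_iff.1 hk with h | rfl
  · exact (F.lmean_le_maxFun h u x).trans (le_max_left _ _)
  · exact le_max_right _ _

end CellFiltration

end IntrinsicMorrey

/-! ### Doob's maximal inequality -/

namespace IntrinsicMorrey

lemma ENNReal_rpow_sub_one_mul_self {q : ℝ} (hq : 1 ≤ q) (a : ℝ≥0∞) : a ^ (q - 1) * a = a ^ q := by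
  conv_lhs => enter [2]; rw [← ENNReal.rpow_one a]
  rw [← ENNReal.rpow_add_of_nonneg _ _ (by linarith) zero_le_one, sub_add_cancel]

lemma ENNReal_max_rpow (a b : ℝ≥0∞) {q : ℝ} (hq : 0 ≤ q) : max a b ^ q = max (a ^ q) (b ^ q) :=
  (ENNReal.monotone_rpow_of_nonneg hq).map_max

/-- Absorption of a fractional power of a finite quantity. -/
lemma ENNReal_le_of_le_mul_rpow {A B K : ℝ≥0∞} {s : ℝ} (hs : 0 < s) (hA : A ≠ ∞)
    (h : A ≤ K * (B ^ s * A ^ (1 - s))) : A ≤ K ^ (1 / s) * B := by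
  rcases eq_or_ne A 0 with rfl | hA0
  · exact zero_le
  have h0 : A ^ (1 - s) ≠ 0 := by simp [hA0, hA]
  have ht : A ^ (1 - s) ≠ ∞ := by simp [hA0, hA]
  have h1 : A ^ s ≤ K * B ^ s := by
    refine (ENNReal.mul_le_mul_iff_left h0 ht).1 ?_
    calc A ^ s * A ^ (1 - s) = A := by rw [← ENNReal.rpow_add _ _ hA0 hA]; simp
      _ ≤ _ := h.trans_eq (mul_assoc _ _ _).symm
  calc A = (A ^ s) ^ (1 / s) := by
        rw [← ENNReal.rpow_mul, mul_one_div_cancel hs.ne', ENNReal.rpow_one]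
    _ ≤ (K * B ^ s) ^ (1 / s) := ENNReal.rpow_le_rpow h1 (by positivity)
    _ = K ^ (1 / s) * B := by
      rw [ENNReal.mul_rpow_of_nonneg _ _ (by positivity), ← ENNReal.rpow_mul B,
        mul_one_div_cancel hs.ne', ENNReal.rpow_one]

/-- The pathwise form of Doob's inequality, (q - 1)(M'^q - M^q) ≤ q (M'^(q-1) - M^(q-1)) b with M' =
max M b, written without subtraction. It is an equality when b ≤ a, and Young's inequality
otherwise. -/
lemma max_rpow_step {q : ℝ} (hq : 1 < q) (a b : ℝ≥0∞) :
    ENNReal.ofReal (q - 1) * max a b ^ q + ENNReal.ofReal q * (a ^ (q - 1) * b) ≤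
      ENNReal.ofReal q * (max a b ^ (q - 1) * b) + ENNReal.ofReal (q - 1) * a ^ q := by
  rcases le_total b a with h | h
  · rw [max_eq_left h, add_comm]
  · rw [max_eq_right h, ENNReal_rpow_sub_one_mul_self hq.le]
    have hQ : ENNReal.ofReal q = ENNReal.ofReal (q - 1) + 1 := by
      rw [← ENNReal.ofReal_one, ← ENNReal.ofReal_add (by linarith) zero_le_one, sub_add_cancel]
    have hq0 : ENNReal.ofReal q ≠ 0 := by simpa using by linarith
    have hconj : q.HolderConjugate (q / (q - 1)) := Real.HolderConjugate.conjExponent hq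
    have hy : ENNReal.ofReal q * (a ^ (q - 1) * b) ≤ b ^ q + ENNReal.ofReal (q - 1) * a ^ q := by
      have := ENNReal.young_inequality b (a ^ (q - 1)) hconj
      rw [← ENNReal.rpow_mul, mul_div_cancel₀ _ (by linarith : q - 1 ≠ 0),
        ENNReal.ofReal_div_of_pos (by linarith)] at this
      calc _ = ENNReal.ofReal q * (b * a ^ (q - 1)) := by rw [mul_comm b]
        _ ≤ ENNReal.ofReal q * (b ^ q / ENNReal.ofReal q +
            a ^ q / (ENNReal.ofReal q / ENNReal.ofReal (q - 1))) := by gcongr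
        _ = _ := by
          rw [mul_add, ENNReal.mul_div_cancel hq0 ENNReal.ofReal_ne_top, div_eq_mul_inv (a ^ q),
            ENNReal.inv_div (Or.inl ENNReal.ofReal_ne_top) (Or.inl (by simpa using hq)),
            mul_comm (a ^ q), ← mul_assoc, ENNReal.mul_div_cancel hq0 ENNReal.ofReal_ne_top]
    calc _ ≤ ENNReal.ofReal (q - 1) * b ^ q + (b ^ q + ENNReal.ofReal (q - 1) * a ^ q) := by gcongr
      _ = _ := by rw [hQ]; ring

namespace CellFiltration

variable {X : Type*} [MeasurableSpace X] {μ : Measure X} {ι : Type*} [MeasurableSpace ι] {D : ℝ≥0}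
  (F : CellFiltration μ ι D) [Countable ι] [MeasurableSingletonClass ι]

/-- Only qualitative: the bound grows with N, but finiteness is what permits the later cancellation
and absorption. -/
lemma lintegral_maxFun_rpow_lt_top (N : ℕ) {u : X → ℝ≥0∞} (hu : Measurable u) {q : ℝ} (hq : 1 ≤ q)
    (hfin : ∫⁻ x, u x ^ q ∂μ < ∞) : ∫⁻ x, F.maxFun N u x ^ q ∂μ < ∞ := by
  have hlt : ∀ k, ∫⁻ x, F.lmean k u x ^ q ∂μ < ∞ := fun k =>
    (F.lintegral_lmean_rpow_le k hu hq).trans_lt hfin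
  induction N with
  | zero => simpa only [maxFun_zero] using hlt 0
  | succ N ih =>
    refine lt_of_le_of_lt (lintegral_mono (g := fun x => F.maxFun N u x ^ q +
      F.lmean (N + 1) u x ^ q) fun x => ?_) ?_
    · simp only [maxFun_succ, ENNReal_max_rpow _ _ (by linarith : 0 ≤ q)]
      exact max_le le_self_add le_add_self
    · rw [lintegral_add_left ((F.measurable_maxFun N u).pow_const q)]
      exact ENNReal.add_lt_top.2 ⟨ih, hlt _⟩

/-- Integrate the pathwise inequality and induct on N. -/
lemma lintegral_maxFun_rpow_le_mul (N : ℕ) {u : X → ℝ≥0∞} (hu : Measurable u) {q : ℝ} (hq : 1 < q)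
    (hfin : ∫⁻ x, u x ^ q ∂μ < ∞) :
    ENNReal.ofReal (q - 1) * ∫⁻ x, F.maxFun N u x ^ q ∂μ ≤
      ENNReal.ofReal q * ∫⁻ x, F.maxFun N u x ^ (q - 1) * F.lmean N u x ∂μ := by
  induction N with
  | zero =>
    simp only [maxFun_zero, ENNReal_rpow_sub_one_mul_self hq.le]
    gcongr
    linarith
  | succ N ih =>
    have hm := F.measurable_maxFun N u
    have hm' := F.measurable_maxFun (N + 1) u
    have hl := F.measurable_lmean (N + 1) u
    -- The maximal function of generation N is constant on cells of generation N, so the average of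
    -- generation N + 1 may be replaced by that of generation N. The cross term then matches the
    -- induction hypothesis.
    have hswap : ∫⁻ x, F.maxFun N u x ^ (q - 1) * F.lmean (N + 1) u x ∂μ =
        ∫⁻ x, F.maxFun N u x ^ (q - 1) * F.lmean N u x ∂μ := by
      simp only [mul_comm (F.maxFun N u _ ^ (q - 1))]
      exact F.lintegral_lmean_succ_mul N hu fun x y h => by rw [F.isConst_maxFun N u x y h]
    have hne : ENNReal.ofReal q * ∫⁻ x, F.maxFun N u x ^ (q - 1) * F.lmean N u x ∂μ ≠ ∞ := by
      refine ENNReal.mul_ne_top ENNReal.ofReal_ne_top (ne_top_of_le_ne_top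
        (F.lintegral_maxFun_rpow_lt_top N hu hq.le hfin).ne (lintegral_mono fun x => ?_))
      rw [← ENNReal_rpow_sub_one_mul_self hq.le]
      gcongr
      exact F.lmean_le_maxFun le_rfl u x
    refine (ENNReal.add_le_add_iff_right hne).1 ?_
    calc _ = ∫⁻ x, (ENNReal.ofReal (q - 1) * F.maxFun (N + 1) u x ^ q +
          ENNReal.ofReal q * (F.maxFun N u x ^ (q - 1) * F.lmean (N + 1) u x)) ∂μ := by
          rw [lintegral_add_left (by fun_prop), lintegral_const_mul _ (by fun_prop),
            lintegral_const_mul _ (by fun_prop), hswap]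
      _ ≤ ∫⁻ x, (ENNReal.ofReal q * (F.maxFun (N + 1) u x ^ (q - 1) * F.lmean (N + 1) u x) +
          ENNReal.ofReal (q - 1) * F.maxFun N u x ^ q) ∂μ := by
          refine lintegral_mono fun x => ?_
          rw [maxFun_succ]
          exact max_rpow_step hq _ _
      _ = ENNReal.ofReal q * ∫⁻ x, F.maxFun (N + 1) u x ^ (q - 1) * F.lmean (N + 1) u x ∂μ +
          ENNReal.ofReal (q - 1) * ∫⁻ x, F.maxFun N u x ^ q ∂μ := by
          rw [lintegral_add_left (by fun_prop), lintegral_const_mul _ (by fun_prop),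
            lintegral_const_mul _ (by fun_prop)]
      _ ≤ _ := by gcongr

/-- The constant in Doob's maximal inequality. -/
def doobConst (q : ℝ) : ℝ≥0∞ := (ENNReal.ofReal q / ENNReal.ofReal (q - 1)) ^ q

lemma doobConst_ne_top {q : ℝ} (hq : 1 < q) : doobConst q ≠ ∞ :=
  ENNReal.rpow_ne_top_of_nonneg (by linarith)
    (ENNReal.div_ne_top ENNReal.ofReal_ne_top (by simpa using hq))

/-- Doob's maximal inequality. -/
lemma lintegral_maxFun_rpow_le (N : ℕ) {u : X → ℝ≥0∞} (hu : Measurable u) {q : ℝ} (hq : 1 < q) :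
    ∫⁻ x, F.maxFun N u x ^ q ∂μ ≤ doobConst q * ∫⁻ x, u x ^ q ∂μ := by
  have hq0 : 0 < q := by linarith
  rcases eq_or_ne (∫⁻ x, u x ^ q ∂μ) ∞ with htop | hfin
  · rw [htop, ENNReal.mul_top]
    · exact le_top
    · simp only [doobConst, ne_eq, ENNReal.rpow_eq_zero_iff, ENNReal.div_eq_zero_iff,
        ENNReal.ofReal_eq_zero, ENNReal.ofReal_ne_top, not_or, not_and]
      exact ⟨by intro h; rcases h with h | h; exacts [by linarith, h.elim], by intro _; linarith⟩
  have hfin' := F.lintegral_maxFun_rpow_lt_top N hu hq.le hfin.lt_top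
  have h1 := F.lintegral_maxFun_rpow_le_mul N hu hq hfin.lt_top
  have hm := F.measurable_maxFun N u
  -- Self-adjointness replaces the average of generation N by u itself; Hölder then leaves a power
  -- of the left-hand side, to be absorbed.
  have h2 : ∫⁻ x, F.maxFun N u x ^ (q - 1) * F.lmean N u x ∂μ ≤
      (∫⁻ x, u x ^ q ∂μ) ^ (1 / q) * (∫⁻ x, F.maxFun N u x ^ q ∂μ) ^ (1 - 1 / q) := by
    simp only [mul_comm (F.maxFun N u _ ^ (q - 1))]
    rw [F.lintegral_lmean_mul N hu fun x y h => by rw [F.isConst_maxFun N u x y h]]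
    refine le_trans (le_of_eq (lintegral_congr fun x => ?_)) (ENNReal.lintegral_mul_norm_pow_le
      (hu.pow_const q).aemeasurable (hm.pow_const q).aemeasurable (by positivity)
      (by rw [sub_nonneg, div_le_one hq0]; exact hq.le) (by ring))
    rw [← ENNReal.rpow_mul, ← ENNReal.rpow_mul, mul_one_div_cancel hq0.ne', ENNReal.rpow_one]
    congr 2
    field_simp
  have hne : ENNReal.ofReal (q - 1) ≠ 0 := by simpa using hq
  have h3 : ∫⁻ x, F.maxFun N u x ^ q ∂μ ≤ ENNReal.ofReal q / ENNReal.ofReal (q - 1) *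
      ((∫⁻ x, u x ^ q ∂μ) ^ (1 / q) * (∫⁻ x, F.maxFun N u x ^ q ∂μ) ^ (1 - 1 / q)) := by
    rw [← ENNReal.mul_div_right_comm, ENNReal.le_div_iff_mul_le (Or.inl hne)
      (Or.inl ENNReal.ofReal_ne_top), mul_comm]
    exact h1.trans (by gcongr)
  simpa [doobConst] using ENNReal_le_of_le_mul_rpow (one_div_pos.2 hq0) hfin'.ne h3

end CellFiltration

end IntrinsicMorrey

/-! ### The weighted energy inequality -/

namespace IntrinsicMorrey

/-- Second order lower bound for `v ↦ v ^ p` at `1`, on `[0, D]`. -/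
lemma second_order_rpow_one {p D v : ℝ} (hp : 1 < p) (hp2 : p ≤ 2) (hD : 1 ≤ D) (hv0 : 0 ≤ v)
    (hvD : v ≤ D) :
    p * (p - 1) / 2 * D ^ (p - 2) * (v - 1) ^ 2 + 1 + p * v ≤ v ^ p + p := by
  set κ := p * (p - 1) / 2 * D ^ (p - 2) with hκ
  -- Since p ≤ 2, x^(p-2) is at least D^(p-2) on (0, D), so κ is exactly what may be subtracted
  -- while keeping the second derivative nonnegative. The claim says that this convex function lies
  -- above its tangent at 1.
  have hconv : ConvexOn ℝ (Icc 0 D) (fun x : ℝ => x ^ p - κ * x ^ 2) := by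
    refine convexOn_of_hasDerivWithinAt2_nonneg (f' := fun x => p * x ^ (p - 1) - κ * (2 * x))
      (f'' := fun x => p * ((p - 1) * x ^ (p - 1 - 1)) - κ * 2) (convex_Icc _ _) ?_ ?_ ?_ ?_
    · exact ((Real.continuous_rpow_const (by linarith)).sub
        (continuous_const.mul (continuous_pow 2))).continuousOn
    · intro x hx
      rw [interior_Icc] at hx
      refine HasDerivAt.hasDerivWithinAt ?_
      have h2 : HasDerivAt (fun x : ℝ => κ * x ^ 2) (κ * (2 * x)) x := by
        simpa using (hasDerivAt_pow 2 x).const_mul κ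
      exact (Real.hasDerivAt_rpow_const (Or.inl hx.1.ne')).sub h2
    · intro x hx
      rw [interior_Icc] at hx
      refine HasDerivAt.hasDerivWithinAt ?_
      have h2 : HasDerivAt (fun x : ℝ => κ * (2 * x)) (κ * 2) x := by
        simpa using ((hasDerivAt_id x).const_mul 2).const_mul κ
      exact ((Real.hasDerivAt_rpow_const (Or.inl hx.1.ne')).const_mul p).sub h2
    · intro x hx
      rw [interior_Icc] at hx
      have h1 : D ^ (p - 2) ≤ x ^ (p - 2) :=
        Real.rpow_le_rpow_of_nonpos hx.1 hx.2.le (by linarith)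
      have h2 : p - 1 - 1 = p - 2 := by ring
      have h3 : 0 ≤ p * (p - 1) := by nlinarith
      rw [h2, hκ]
      nlinarith [mul_le_mul_of_nonneg_left h1 h3]
  have hd : HasDerivAt (fun x : ℝ => x ^ p - κ * x ^ 2) (p - κ * 2) 1 := by
    have h1 := Real.hasDerivAt_rpow_const (x := 1) (p := p) (Or.inl one_ne_zero)
    have h2 := (hasDerivAt_pow 2 (1 : ℝ)).const_mul κ
    have h3 : HasDerivAt (fun x : ℝ => x ^ p - κ * x ^ 2) _ 1 := h1.sub h2
    simpa using h3
  have key : (1 : ℝ) ^ p - κ * 1 ^ 2 + (p - κ * 2) * (v - 1) ≤ v ^ p - κ * v ^ 2 := by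
    have hv : v ∈ Icc 0 D := ⟨hv0, hvD⟩
    have h1 : (1 : ℝ) ∈ Icc 0 D := ⟨zero_le_one, hD⟩
    rcases lt_trichotomy v 1 with h | h | h
    · have := hconv.slope_le_of_hasDerivAt hv h1 h hd
      rw [slope_def_field, div_le_iff₀ (by linarith)] at this
      linarith
    · subst h; simp
    · have := hconv.le_slope_of_hasDerivAt h1 hv h hd
      rw [slope_def_field, le_div_iff₀ (by linarith)] at this
      linarith
  rw [Real.one_rpow] at key
  nlinarith [key]

/-- Second order lower bound for `u ↦ u ^ p` at `c`, on `[0, D * c]`. -/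
lemma second_order_rpow {p D c u : ℝ} (hp : 1 < p) (hp2 : p ≤ 2) (hD : 1 ≤ D) (hc : 0 < c)
    (hu0 : 0 ≤ u) (huD : u ≤ D * c) :
    p * (p - 1) / 2 * D ^ (p - 2) * ((u - c) ^ 2 * c ^ (p - 2)) + c ^ p + p * (c ^ (p - 1) * u) ≤
      u ^ p + p * c ^ p := by
  -- By homogeneity it is enough to take c = 1: put v = u / c and multiply by c^p.
  have h := second_order_rpow_one hp hp2 hD (div_nonneg hu0 hc.le) ((div_le_iff₀ hc).2 huD)
  have hcp : 0 < c ^ p := Real.rpow_pos_of_pos hc p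
  have h1 : c ^ (p - 2) = c ^ p / c ^ 2 := by
    rw [Real.rpow_sub hc, Real.rpow_two]
  have h2 : c ^ (p - 1) = c ^ p / c := by rw [Real.rpow_sub hc, Real.rpow_one]
  rw [Real.div_rpow hu0 hc.le] at h
  have := mul_le_mul_of_nonneg_right h hcp.le
  rw [h1, h2]
  clear h h1 h2
  generalize D ^ (p - 2) = d at *
  generalize c ^ p = e at *
  generalize u ^ p = w at *
  have h3 : u / c - 1 = (u - c) / c := by field_simp
  rw [h3, div_pow] at this
  calc _ = (p * (p - 1) / 2 * d * ((u - c) ^ 2 / c ^ 2) + 1 + p * (u / c)) * e := by ring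
    _ ≤ (w / e + p) * e := this
    _ = _ := by rw [add_mul, div_mul_cancel₀ _ hcp.ne']

namespace CellFiltration

variable {X : Type*} [MeasurableSpace X] {μ : Measure X} {ι : Type*} [MeasurableSpace ι] {D : ℝ≥0}
  (F : CellFiltration μ ι D)

lemma ofReal_mean (k : ℕ) {f : X → ℝ} (hf : Integrable f μ) (h0 : ∀ x, 0 ≤ f x) (x : X) :
    ENNReal.ofReal (F.mean k f x) = F.lmean k (fun y => ENNReal.ofReal (f y)) x := by
  rw [mean, lmean, ofReal_setAverage hf.integrableOn (ae_of_all _ h0), setLAverage_eq]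

lemma mean_nonneg (k : ℕ) {f : X → ℝ} (h0 : ∀ x, 0 ≤ f x) (x : X) : 0 ≤ F.mean k f x := by
  rw [mean, setAverage_eq]
  exact smul_nonneg (by positivity) (integral_nonneg h0)

/-- Doubling of the cells bounds the jumps upwards: passing to a child multiplies the average by at
most D. This keeps the averages in the range of the second-order bound. -/
lemma lmean_succ_le (k : ℕ) (u : X → ℝ≥0∞) (x : X) :
    F.lmean (k + 1) u x ≤ D * F.lmean k u x := by
  have h0 := F.measure_ne_zero (k + 1) x
  have ht := F.measure_ne_top (k + 1) x
  refine (ENNReal.mul_le_mul_iff_right h0 ht).1 ?_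
  calc _ = ∫⁻ y in F.cell (k + 1) x, u y ∂μ := F.measure_mul_lmean (k + 1) u x
    _ ≤ ∫⁻ y in F.cell k x, u y ∂μ := lintegral_mono_set (F.cell_subset_of_le k.le_succ x)
    _ = μ (F.cell k x) * F.lmean k u x := (F.measure_mul_lmean k u x).symm
    _ ≤ (D * μ (F.cell (k + 1) x)) * F.lmean k u x := by gcongr; exact F.doubling k x
    _ = _ := by rw [cell]; ring

lemma mean_succ_le (k : ℕ) {f : X → ℝ} (hf : Integrable f μ) (h0 : ∀ x, 0 ≤ f x) (x : X) :
    F.mean (k + 1) f x ≤ D * F.mean k f x := by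
  have h := F.lmean_succ_le k (fun y => ENNReal.ofReal (f y)) x
  rw [← F.ofReal_mean _ hf h0, ← F.ofReal_mean _ hf h0, ← ENNReal.ofReal_coe_nnreal,
    ← ENNReal.ofReal_mul (by positivity)] at h
  exact (ENNReal.ofReal_le_ofReal_iff (mul_nonneg D.2 (F.mean_nonneg k h0 x))).1 h

/-- The constant in the energy inequality. -/
def energyConst (p : ℝ) (D : ℝ≥0) : ℝ≥0∞ := ENNReal.ofReal (p * (p - 1) / 2 * (D : ℝ) ^ (p - 2))

/-- The second-order bound at c = E_k f and u = E_{k+1} f, with the first-order terms distributed so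
that every term is nonnegative. -/
lemma energy_pointwise {p : ℝ} (hp : 1 < p) (hp2 : p ≤ 2) (hD : 1 ≤ D) (k : ℕ) {f : X → ℝ}
    (hf : Integrable f μ) (h0 : ∀ x, 0 ≤ f x) (x : X) :
    energyConst p D * (‖F.diff k f x‖ₑ ^ 2 *
        F.lmean k (fun y => ENNReal.ofReal (f y)) x ^ (p - 2)) +
      F.lmean k (fun y => ENNReal.ofReal (f y)) x ^ p +
      ENNReal.ofReal p * (F.lmean k (fun y => ENNReal.ofReal (f y)) x ^ (p - 1) *
        F.lmean (k + 1) (fun y => ENNReal.ofReal (f y)) x) ≤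
    F.lmean (k + 1) (fun y => ENNReal.ofReal (f y)) x ^ p +
      ENNReal.ofReal p * F.lmean k (fun y => ENNReal.ofReal (f y)) x ^ p := by
  rw [← F.ofReal_mean _ hf h0, ← F.ofReal_mean _ hf h0]
  have hu := F.mean_nonneg (k + 1) h0 x
  have hle := F.mean_succ_le k hf h0 x
  have hD1 : (1 : ℝ) ≤ D := by exact_mod_cast hD
  rcases (F.mean_nonneg k h0 x).eq_or_lt with hc | hc
  · have h1 : F.mean (k + 1) f x = 0 := by
      rw [← hc, mul_zero] at hle; exact le_antisymm hle hu
    have h2 : (0 : ℝ≥0∞) ^ p = 0 := ENNReal.zero_rpow_of_pos (by linarith)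
    simp [diff, h1, ← hc, h2]
  · have hd : ‖F.diff k f x‖ₑ ^ 2 = ENNReal.ofReal ((F.mean (k + 1) f x - F.mean k f x) ^ 2) := by
      rw [← enorm_pow, Real.enorm_eq_ofReal (sq_nonneg _), diff]
    rw [hd, energyConst, ENNReal.ofReal_rpow_of_pos hc, ENNReal.ofReal_rpow_of_pos hc,
      ENNReal.ofReal_rpow_of_pos hc, ENNReal.ofReal_rpow_of_nonneg hu (by linarith),
      ← ENNReal.ofReal_mul (by positivity), ← ENNReal.ofReal_mul (by positivity),
      ← ENNReal.ofReal_mul (by positivity), ← ENNReal.ofReal_mul (by positivity),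
      ← ENNReal.ofReal_mul (by positivity), ← ENNReal.ofReal_add (by positivity) (by positivity),
      ← ENNReal.ofReal_add (by positivity) (by positivity),
      ← ENNReal.ofReal_add (by positivity) (by positivity)]
    exact ENNReal.ofReal_le_ofReal (second_order_rpow hp hp2 hD1 hc hu hle)

variable [Countable ι] [MeasurableSingletonClass ι]

/-- Tower property, by testing against the indicator of the coarser cell, which is constant on finer
cells. -/
lemma setLIntegral_lmean_of_le {j k : ℕ} (hjk : j ≤ k) {u : X → ℝ≥0∞} (hu : Measurable u) (x : X) :
    ∫⁻ y in F.cell j x, F.lmean k u y ∂μ = ∫⁻ y in F.cell j x, u y ∂μ := by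
  have hc : F.IsConst j ((F.cell j x).indicator (fun _ => (1 : ℝ≥0∞))) := fun y z h => by
    have hyz : y ∈ F.cell j x ↔ z ∈ F.cell j x := by simp only [cell, mem_ofPred_eq, h]
    by_cases hz : z ∈ F.cell j x
    · rw [indicator_of_mem hz, indicator_of_mem (hyz.2 hz)]
    · rw [indicator_of_notMem hz, indicator_of_notMem (mt hyz.1 hz)]
  have := F.lintegral_lmean_mul k hu (hc.mono hjk)
  simpa only [← inter_indicator_mul, mul_one, indicator_mul_right,
    lintegral_indicator (F.measurableSet_cell j x), ← indicator_mul_right (F.cell j x),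
    Pi.one_apply] using this

/-- After integration over one cell of generation k the first-order terms cancel. Working on a
single cell makes the cancelled quantity finite, as E_k f is a finite constant there, without
assuming f in L^p. -/
lemma energy_cell {p : ℝ} (hp : 1 < p) (hp2 : p ≤ 2) (hD : 1 ≤ D) (k : ℕ) {f : X → ℝ}
    (hfm : Measurable f) (hf : Integrable f μ) (h0 : ∀ x, 0 ≤ f x) (x : X) :
    energyConst p D * (∫⁻ y in F.cell k x, ‖F.diff k f y‖ₑ ^ 2 *
        F.lmean k (fun y => ENNReal.ofReal (f y)) y ^ (p - 2) ∂μ) +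
      ∫⁻ y in F.cell k x, F.lmean k (fun y => ENNReal.ofReal (f y)) y ^ p ∂μ ≤
    ∫⁻ y in F.cell k x, F.lmean (k + 1) (fun y => ENNReal.ofReal (f y)) y ^ p ∂μ := by
  set U := fun y => ENNReal.ofReal (f y) with hU
  have hUm : Measurable U := by fun_prop
  have hm := F.measurable_lmean k U
  have hm' := F.measurable_lmean (k + 1) U
  have hd := F.measurable_diff k f
  have hcross : ∫⁻ y in F.cell k x, F.lmean k U y ^ (p - 1) * F.lmean (k + 1) U y ∂μ =
      ∫⁻ y in F.cell k x, F.lmean k U y ^ p ∂μ := by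
    have hc : F.IsConst k (fun y => F.lmean k U y ^ (p - 1)) := fun y z h => by
      simp only [F.isConst_lmean k U y z h]
    simp only [← ENNReal_rpow_sub_one_mul_self hp.le, mul_comm (F.lmean k U _ ^ (p - 1))]
    rw [F.setLIntegral_mul_isConst hm' hc, F.setLIntegral_mul_isConst hm hc,
      F.setLIntegral_lmean_of_le k.le_succ hUm, F.setLIntegral_lmean]
  have hne : ENNReal.ofReal p * ∫⁻ y in F.cell k x, F.lmean k U y ^ p ∂μ ≠ ∞ := by
    rw [F.setLIntegral_isConst fun y z h => by simp only [F.isConst_lmean k U y z h]]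
    refine ENNReal.mul_ne_top ENNReal.ofReal_ne_top (ENNReal.mul_ne_top ?_ (F.measure_ne_top k x))
    rw [← F.ofReal_mean k hf h0]
    exact ENNReal.rpow_ne_top_of_nonneg (by linarith) ENNReal.ofReal_ne_top
  refine (ENNReal.add_le_add_iff_right hne).1 ?_
  calc _ = ∫⁻ y in F.cell k x, (energyConst p D * (‖F.diff k f y‖ₑ ^ 2 * F.lmean k U y ^ (p - 2)) +
        F.lmean k U y ^ p + ENNReal.ofReal p * (F.lmean k U y ^ (p - 1) *
           F.lmean (k + 1) U y)) ∂μ := by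
        rw [lintegral_add_left (by fun_prop), lintegral_add_left (by fun_prop),
          lintegral_const_mul _ (by fun_prop), lintegral_const_mul _ (by fun_prop), hcross]
    _ ≤ ∫⁻ y in F.cell k x, (F.lmean (k + 1) U y ^ p + ENNReal.ofReal p * F.lmean k U y ^ p) ∂μ :=
        lintegral_mono fun y => F.energy_pointwise hp hp2 hD k hf h0 y
    _ = _ := by rw [lintegral_add_left (by fun_prop), lintegral_const_mul _ (by fun_prop)]

lemma energy_step {p : ℝ} (hp : 1 < p) (hp2 : p ≤ 2) (hD : 1 ≤ D) (k : ℕ) {f : X → ℝ}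
    (hfm : Measurable f) (hf : Integrable f μ) (h0 : ∀ x, 0 ≤ f x) {W : X → ℝ≥0∞}
    (hW : F.IsConst k W) :
    energyConst p D * (∫⁻ y, ‖F.diff k f y‖ₑ ^ 2 *
        F.lmean k (fun y => ENNReal.ofReal (f y)) y ^ (p - 2) * W y ∂μ) +
      ∫⁻ y, F.lmean k (fun y => ENNReal.ofReal (f y)) y ^ p * W y ∂μ ≤
    ∫⁻ y, F.lmean (k + 1) (fun y => ENNReal.ofReal (f y)) y ^ p * W y ∂μ := by
  set U := fun y => ENNReal.ofReal (f y) with hU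
  have hm := F.measurable_lmean k U
  have hm' := F.measurable_lmean (k + 1) U
  have hd := F.measurable_diff k f
  have hWm := hW.measurable
  rw [← lintegral_const_mul _ (by fun_prop), ← lintegral_add_left (by fun_prop)]
  refine F.lintegral_le_of_cells k fun x => ?_
  simp only [← mul_assoc (energyConst p D), ← add_mul]
  rw [F.setLIntegral_mul_isConst (by fun_prop) hW, F.setLIntegral_mul_isConst (by fun_prop) hW,
    lintegral_add_left (by fun_prop)]
  simp only [mul_assoc (energyConst p D)]
  rw [lintegral_const_mul _ (by fun_prop)]
  gcongr
  exact F.energy_cell hp hp2 hD k hfm hf h0 x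

/-- Weighted energy inequality: the weights are predictable and increase with the generation. -/
lemma energy_sum {p : ℝ} (hp : 1 < p) (hp2 : p ≤ 2) (hD : 1 ≤ D) {f : X → ℝ}
    (hfm : Measurable f) (hf : Integrable f μ) (h0 : ∀ x, 0 ≤ f x) {W : ℕ → X → ℝ≥0∞}
    (hW : ∀ k, F.IsConst k (W k)) (hmono : ∀ k x, W k x ≤ W (k + 1) x) (N : ℕ) :
    energyConst p D * ∑ k ∈ Finset.range N, ∫⁻ y, ‖F.diff k f y‖ₑ ^ 2 *
        F.lmean k (fun y => ENNReal.ofReal (f y)) y ^ (p - 2) * W k y ∂μ ≤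
      ∫⁻ y, ENNReal.ofReal (f y) ^ p * W N y ∂μ := by
  set U := fun y => ENNReal.ofReal (f y) with hU
  have hUm : Measurable U := by fun_prop
  have key : ∀ N, energyConst p D * ∑ k ∈ Finset.range N, ∫⁻ y, ‖F.diff k f y‖ₑ ^ 2 *
      F.lmean k U y ^ (p - 2) * W k y ∂μ ≤ ∫⁻ y, F.lmean N U y ^ p * W N y ∂μ := by
    intro N
    induction N with
    | zero => simp
    | succ N ih =>
      rw [Finset.sum_range_succ, mul_add, add_comm]
      calc _ ≤ energyConst p D * (∫⁻ y, ‖F.diff N f y‖ₑ ^ 2 *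
            F.lmean N U y ^ (p - 2) * W N y ∂μ) + ∫⁻ y, F.lmean N U y ^ p * W N y ∂μ := by gcongr
        _ ≤ _ := F.energy_step hp hp2 hD N hfm hf h0 (hW N)
        -- Monotonicity of the weights is what lets the sum telescope.
        _ ≤ _ := by gcongr with y; exact hmono N y
  refine (key N).trans ?_
  rw [← F.lintegral_lmean_mul N (hUm.pow_const p) (hW N)]
  gcongr with y
  exact F.rpow_lmean_le N hUm hp.le y

end CellFiltration

end IntrinsicMorrey

/-! ### Square functions of averaged martingale differences in L^p -/

namespace IntrinsicMorrey

namespace CellFiltration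

variable {X : Type*} [MeasurableSpace X] {μ : Measure X} {ι : Type*} [MeasurableSpace ι] {D : ℝ≥0}
  (F : CellFiltration μ ι D)

lemma energyConst_two (D : ℝ≥0) : energyConst 2 D = 1 := by
  rw [energyConst]; norm_num

lemma energyConst_ne_zero {p : ℝ} (hp : 1 < p) (hD : 1 ≤ D) : energyConst p D ≠ 0 := by
  have hD1 : (0 : ℝ) < D := lt_of_lt_of_le one_pos (by exact_mod_cast hD)
  have h1 : 0 < p - 1 := by linarith
  simpa [energyConst] using by positivity

lemma enorm_diff_le (k : ℕ) {f : X → ℝ} (hf : Integrable f μ) (h0 : ∀ x, 0 ≤ f x) (x : X) :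
    ‖F.diff k f x‖ₑ ≤ F.lmean (k + 1) (fun y => ENNReal.ofReal (f y)) x +
      F.lmean k (fun y => ENNReal.ofReal (f y)) x := by
  rw [← F.ofReal_mean _ hf h0, ← F.ofReal_mean _ hf h0,
    ← Real.enorm_eq_ofReal (F.mean_nonneg _ h0 x), ← Real.enorm_eq_ofReal (F.mean_nonneg _ h0 x)]
  exact enorm_sub_le

/-- Splits off a power of E_k f in preparation for Cauchy–Schwarz: the first factor is the energy
density, the second is controlled by the maximal function. -/
lemma enorm_diff_le_factor (p : ℝ) (k : ℕ) {f : X → ℝ} (hf : Integrable f μ) (h0 : ∀ x, 0 ≤ f x)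
    (x : X) :
    ‖F.diff k f x‖ₑ ≤ (‖F.diff k f x‖ₑ ^ 2 *
        F.lmean k (fun y => ENNReal.ofReal (f y)) x ^ (p - 2)) ^ (1 / 2 : ℝ) *
      (F.lmean k (fun y => ENNReal.ofReal (f y)) x ^ (2 - p)) ^ (1 / 2 : ℝ) := by
  rw [← F.ofReal_mean _ hf h0]
  rcases (F.mean_nonneg k h0 x).eq_or_lt with hc | hc
  · have h1 : F.mean (k + 1) f x = 0 := by
      have hle := F.mean_succ_le k hf h0 x
      rw [← hc, mul_zero] at hle; exact le_antisymm hle (F.mean_nonneg (k + 1) h0 x)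
    simp [diff, h1, ← hc]
  · have hne : ENNReal.ofReal (F.mean k f x) ≠ 0 := by simpa using hc
    rw [← ENNReal.mul_rpow_of_nonneg _ _ (by norm_num), mul_assoc,
      ← ENNReal.rpow_add _ _ hne ENNReal.ofReal_ne_top]
    norm_num
    rw [← ENNReal.rpow_natCast, ← ENNReal.rpow_mul]
    norm_num

/-- Squares of averages of martingale differences `m` generations below. -/
def shiftSq (m : ℕ) (f : X → ℝ) (k : ℕ) (x : X) : ℝ≥0∞ :=
  F.lmean k (fun y => ‖F.diff (k + m) f y‖ₑ) x ^ 2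

variable [Countable ι] [MeasurableSingletonClass ι]

lemma lmean_lmean {j k : ℕ} (hjk : j ≤ k) {u : X → ℝ≥0∞} (hu : Measurable u) (x : X) :
    F.lmean j (F.lmean k u) x = F.lmean j u x := by
  rw [lmean, setLAverage_eq, F.setLIntegral_lmean_of_le hjk hu, lmean, setLAverage_eq]

lemma measurable_shiftSq (m : ℕ) (f : X → ℝ) (k : ℕ) : Measurable (F.shiftSq m f k) :=
  (F.measurable_lmean _ _).pow_const 2

lemma sum_shift_le (a : ℕ → ℝ≥0∞) (m N : ℕ) :
    ∑ k ∈ Finset.range N, a (k + m) ≤ ∑ j ∈ Finset.range (N + m), a j := by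
  rw [add_comm N m, Finset.sum_range_add]
  simp only [add_comm m]
  exact le_add_self

/-- Cauchy–Schwarz on the cell for the preceding factorization, then Jensen for the power 2 - p in
[0, 1) and the tower property, to return from E_{k+m} f to E_k f. -/
lemma shiftSq_le_of_le_two {p : ℝ} (hp : 1 < p) (hp2 : p ≤ 2) (m : ℕ) {f : X → ℝ}
    (hfm : Measurable f) (hf : Integrable f μ) (h0 : ∀ x, 0 ≤ f x) (k : ℕ) (x : X) :
    F.shiftSq m f k x ≤ F.lmean k (fun y => ‖F.diff (k + m) f y‖ₑ ^ 2 *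
        F.lmean (k + m) (fun y => ENNReal.ofReal (f y)) y ^ (p - 2)) x *
      F.lmean k (fun y => ENNReal.ofReal (f y)) x ^ (2 - p) := by
  set U := fun y => ENNReal.ofReal (f y) with hU
  have hUm : Measurable U := by fun_prop
  have hm := F.measurable_lmean (k + m) U
  have hd := F.measurable_diff (k + m) f
  have h1 := (F.lmean_mono (k := k) (x := x)
    fun y => F.enorm_diff_le_factor p (k + m) hf h0 y).trans
      (F.lmean_mul_rpow_le k (by fun_prop) (by fun_prop) x)
  have h2 : F.lmean k (fun y => F.lmean (k + m) U y ^ (2 - p)) x ≤ F.lmean k U x ^ (2 - p) := by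
    rw [← F.lmean_lmean (Nat.le_add_right k m) hUm]
    exact F.lmean_rpow_le k hm (by linarith) (by linarith) x
  calc F.shiftSq m f k x ≤ _ := pow_le_pow_left₀ zero_le h1 2
    _ = _ := by
      have e : (1 / 2 : ℝ) * ((2 : ℕ) : ℝ) = 1 := by norm_num
      rw [mul_pow, ← ENNReal.rpow_mul_natCast, ← ENNReal.rpow_mul_natCast, e, ENNReal.rpow_one,
        ENNReal.rpow_one]
    _ ≤ _ := by gcongr

/-- Bound (E_k f)^(2-p) by the maximal function and apply Hölder with exponents p/2 and 1 - p/2.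
Averaging preserves integrals, so the energy factor is a shifted piece of the energy sum and the
bound does not depend on m. -/
lemma lintegral_sum_shiftSq_le_of_le_two {p : ℝ} (hp : 1 < p) (hp2 : p ≤ 2) (hD : 1 ≤ D) (m : ℕ)
    {f : X → ℝ} (hfm : Measurable f) (hf : Integrable f μ) (h0 : ∀ x, 0 ≤ f x) (N : ℕ) :
    ∫⁻ x, (∑ k ∈ Finset.range N, F.shiftSq m f k x) ^ (p / 2) ∂μ ≤
      ((energyConst p D)⁻¹ ^ (p / 2) * doobConst p ^ (1 - p / 2)) *
        ∫⁻ x, ENNReal.ofReal (f x) ^ p ∂μ := by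
  set U := fun y => ENNReal.ofReal (f y) with hU
  have hUm : Measurable U := by fun_prop
  have hm := fun k => F.measurable_lmean k U
  have hd := fun k => F.measurable_diff k f
  have hM := F.measurable_maxFun N U
  set G : ℕ → X → ℝ≥0∞ := fun k => F.lmean k (fun y => ‖F.diff (k + m) f y‖ₑ ^ 2 *
        F.lmean (k + m) U y ^ (p - 2)) with hG
  have hGm : ∀ k, Measurable (G k) := fun k => F.measurable_lmean _ _
  have hGint : ∫⁻ x, ∑ k ∈ Finset.range N, G k x ∂μ ≤ (energyConst p D)⁻¹ * ∫⁻ x, U x ^ p ∂μ := by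
    rw [lintegral_finsetSum _ fun k _ => hGm k]
    have h1 : ∀ k, ∫⁻ x, G k x ∂μ = ∫⁻ y, ‖F.diff (k + m) f y‖ₑ ^ 2 *
        F.lmean (k + m) U y ^ (p - 2) ∂μ := fun k => by
      have := hd (k + m)
      have := hm (k + m)
      exact F.lintegral_lmean k (by fun_prop)
    simp only [h1]
    refine (sum_shift_le (fun k => ∫⁻ y, ‖F.diff k f y‖ₑ ^ 2 *
        F.lmean k U y ^ (p - 2) ∂μ) m N).trans ?_
    have h2 := F.energy_sum hp hp2 hD hfm hf h0 (W := fun _ _ => 1) (fun _ _ _ _ => rfl)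
      (fun _ _ => le_rfl) (N + m)
    simp only [mul_one] at h2
    rw [mul_comm, ← div_eq_mul_inv, ENNReal.le_div_iff_mul_le (Or.inl (energyConst_ne_zero hp hD))
      (Or.inl ENNReal.ofReal_ne_top), mul_comm]
    exact h2
  have hpt : ∀ x, (∑ k ∈ Finset.range N, F.shiftSq m f k x) ^ (p / 2) ≤
      (∑ k ∈ Finset.range N, G k x) ^ (p / 2) * (F.maxFun N U x ^ p) ^ (1 - p / 2) := by
    intro x
    calc _ ≤ ((∑ k ∈ Finset.range N, G k x) * F.maxFun N U x ^ (2 - p)) ^ (p / 2) := by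
          refine ENNReal.rpow_le_rpow ?_ (by linarith)
          rw [Finset.sum_mul]
          refine Finset.sum_le_sum fun k hk =>
            (F.shiftSq_le_of_le_two hp hp2 m hfm hf h0 k x).trans ?_
          gcongr
          exact F.lmean_le_maxFun (Finset.mem_range.1 hk).le U x
      _ = _ := by
          rw [ENNReal.mul_rpow_of_nonneg _ _ (by linarith), ← ENNReal.rpow_mul, ← ENNReal.rpow_mul]
          congr 2
          ring
  have hp0 : 0 ≤ p / 2 := by linarith
  have hp1 : 0 ≤ 1 - p / 2 := by linarith
  calc _ ≤ _ := lintegral_mono hpt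
    _ ≤ (∫⁻ x, ∑ k ∈ Finset.range N, G k x ∂μ) ^ (p / 2) *
        (∫⁻ x, F.maxFun N U x ^ p ∂μ) ^ (1 - p / 2) :=
        ENNReal.lintegral_mul_norm_pow_le (by fun_prop) (by fun_prop) hp0 hp1 (by ring)
    _ ≤ ((energyConst p D)⁻¹ * ∫⁻ x, U x ^ p ∂μ) ^ (p / 2) *
        (doobConst p * ∫⁻ x, U x ^ p ∂μ) ^ (1 - p / 2) := by
        gcongr
        exact F.lintegral_maxFun_rpow_le N hUm hp
    _ = ((energyConst p D)⁻¹ ^ (p / 2) * doobConst p ^ (1 - p / 2)) *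
        ((∫⁻ x, U x ^ p ∂μ) ^ (p / 2) * (∫⁻ x, U x ^ p ∂μ) ^ (1 - p / 2)) := by
        rw [ENNReal.mul_rpow_of_nonneg _ _ hp0, ENNReal.mul_rpow_of_nonneg _ _ hp1]
        ring
    _ = _ := by
        rw [← ENNReal.rpow_add_of_nonneg _ _ hp0 hp1, add_sub_cancel, ENNReal.rpow_one]

lemma lintegral_lmean_diff_rpow_lt_top {p : ℝ} (hp : 1 < p) (m k : ℕ)
    {f : X → ℝ} (hfm : Measurable f) (hf : Integrable f μ) (h0 : ∀ x, 0 ≤ f x)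
    (hfin : ∫⁻ x, ENNReal.ofReal (f x) ^ p ∂μ < ∞) :
    ∫⁻ x, F.shiftSq m f k x ^ (p / 2) ∂μ < ∞ := by
  have hUm : Measurable fun y => ENNReal.ofReal (f y) := by fun_prop
  have hm := fun k => F.measurable_lmean k (fun y => ENNReal.ofReal (f y))
  have hd := F.measurable_diff (k + m) f
  have hlt : ∀ k, ∫⁻ x, F.lmean k (fun y => ENNReal.ofReal (f y)) x ^ p ∂μ < ∞ := fun k =>
    (F.lintegral_lmean_rpow_le k hUm hp.le).trans_lt hfin
  calc _ = ∫⁻ x, F.lmean k (fun y => ‖F.diff (k + m) f y‖ₑ) x ^ p ∂μ := by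
        simp only [shiftSq, ← ENNReal.rpow_natCast, ← ENNReal.rpow_mul]
        congr! 3
        push_cast; ring
    _ ≤ ∫⁻ x, ‖F.diff (k + m) f x‖ₑ ^ p ∂μ := F.lintegral_lmean_rpow_le k (by fun_prop) hp.le
    _ ≤ ∫⁻ x, (F.lmean (k + m + 1) (fun y => ENNReal.ofReal (f y)) +
          F.lmean (k + m) (fun y => ENNReal.ofReal (f y))) x ^ p ∂μ :=
        lintegral_mono fun x => ENNReal.rpow_le_rpow (F.enorm_diff_le (k + m) hf h0 x) (by linarith)
    _ < ∞ := ENNReal.lintegral_rpow_add_lt_top_of_lintegral_rpow_lt_top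
        (hm _).aemeasurable (hlt _) (hlt _) hp.le

/-- Qualitative finiteness, needed for the absorption in the case p > 2. -/
lemma lintegral_sum_shiftSq_lt_top {p : ℝ} (hp : 2 < p) (m : ℕ)
    {f : X → ℝ} (hfm : Measurable f) (hf : Integrable f μ) (h0 : ∀ x, 0 ≤ f x)
    (hfin : ∫⁻ x, ENNReal.ofReal (f x) ^ p ∂μ < ∞) (N : ℕ) :
    ∫⁻ x, (∑ k ∈ Finset.range N, F.shiftSq m f k x) ^ (p / 2) ∂μ < ∞ := by
  have hs := F.measurable_shiftSq m f
  induction N with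
  | zero => simp [show 0 < p / 2 by linarith]
  | succ N ih =>
    simp only [Finset.sum_range_succ]
    exact ENNReal.lintegral_rpow_add_lt_top_of_lintegral_rpow_lt_top
      (f := fun x => ∑ k ∈ Finset.range N, F.shiftSq m f k x) (by fun_prop) ih
      (F.lintegral_lmean_diff_rpow_lt_top (by linarith) m N hfm hf h0 hfin) (by linarith)

/-- The square function is bounded in weighted `L²`, with a maximal function of the weight. -/
lemma lintegral_sum_shiftSq_mul_le (hD : 1 ≤ D) (m : ℕ) {f : X → ℝ} (hfm : Measurable f)
    (hf : Integrable f μ) (h0 : ∀ x, 0 ≤ f x) (N : ℕ) {w : X → ℝ≥0∞} (hw : Measurable w) :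
    ∫⁻ x, (∑ k ∈ Finset.range N, F.shiftSq m f k x) * w x ∂μ ≤
      ∫⁻ x, ENNReal.ofReal (f x) ^ (2 : ℝ) * F.maxFun (N + m) w x ∂μ := by
  have hs := F.measurable_shiftSq m f
  have hd := fun k => F.measurable_diff k f
  have hM := fun k => F.measurable_maxFun k w
  -- Jensen brings the square inside the average, self-adjointness moves the average onto w, and the
  -- maximal function of generation k + m gives a weight admissible for the energy inequality.
  have hterm : ∀ k, ∫⁻ x, F.shiftSq m f k x * w x ∂μ ≤
      ∫⁻ x, ‖F.diff (k + m) f x‖ₑ ^ 2 * F.maxFun (k + m) w x ∂μ := by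
    intro k
    have hdk := hd (k + m)
    calc _ ≤ ∫⁻ x, F.lmean k (fun y => ‖F.diff (k + m) f y‖ₑ ^ 2) x * w x ∂μ := by
          gcongr with x
          have := F.rpow_lmean_le k (u := fun y => ‖F.diff (k + m) f y‖ₑ) (by fun_prop)
            (one_le_two) x
          simpa only [ENNReal.rpow_two, shiftSq] using this
      _ = ∫⁻ x, ‖F.diff (k + m) f x‖ₑ ^ 2 * F.lmean k w x ∂μ :=
          F.lintegral_lmean_mul_comm k (by fun_prop) hw
      _ ≤ _ := by
          gcongr with x
          exact F.lmean_le_maxFun (Nat.le_add_right k m) w x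
  have hE := F.energy_sum one_lt_two le_rfl hD hfm hf h0 (F.isConst_maxFun · w)
    (fun k x => F.maxFun_mono k.le_succ w x) (N + m)
  simp only [energyConst_two, one_mul, sub_self, ENNReal.rpow_zero, mul_one] at hE
  simp only [Finset.sum_mul]
  rw [lintegral_finsetSum _ fun k _ => by fun_prop]
  exact (Finset.sum_le_sum fun k _ => hterm k).trans ((sum_shift_le (fun k =>
    ∫⁻ x, ‖F.diff k f x‖ₑ ^ 2 * F.maxFun k w x ∂μ) m N).trans hE)

/-- Duality with the extremal weight w = H^(p/2-1). The exponent p/(p-2) is conjugate to p/2 and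
turns w into H^(p/2), so that Doob's inequality produces a power of the left-hand side, which is
absorbed. -/
lemma lintegral_sum_shiftSq_le_of_two_lt {p : ℝ} (hp : 2 < p) (hD : 1 ≤ D) (m : ℕ)
    {f : X → ℝ} (hfm : Measurable f) (hf : Integrable f μ) (h0 : ∀ x, 0 ≤ f x)
    (hfin : ∫⁻ x, ENNReal.ofReal (f x) ^ p ∂μ < ∞) (N : ℕ) :
    ∫⁻ x, (∑ k ∈ Finset.range N, F.shiftSq m f k x) ^ (p / 2) ∂μ ≤
      (doobConst (p / (p - 2)) ^ (1 - 2 / p)) ^ (1 / (2 / p)) *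
        ∫⁻ x, ENNReal.ofReal (f x) ^ p ∂μ := by
  set H : X → ℝ≥0∞ := fun x => ∑ k ∈ Finset.range N, F.shiftSq m f k x with hH
  have hs := F.measurable_shiftSq m f
  have hHm : Measurable H := by fun_prop
  have hM := F.measurable_maxFun (N + m) (fun x => H x ^ (p / 2 - 1))
  have hp2 : 0 < p - 2 := by linarith
  have hq : 1 < p / (p - 2) := by rw [lt_div_iff₀ hp2]; linarith
  have hp1 : 0 ≤ 1 - 2 / p := by rw [sub_nonneg, div_le_one (by linarith)]; exact hp.le
  refine ENNReal_le_of_le_mul_rpow (by positivity)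
    (F.lintegral_sum_shiftSq_lt_top hp m hfm hf h0 hfin N).ne ?_
  calc ∫⁻ x, H x ^ (p / 2) ∂μ = ∫⁻ x, H x * H x ^ (p / 2 - 1) ∂μ := by
        simp only [mul_comm (H _), ENNReal_rpow_sub_one_mul_self (by linarith : 1 ≤ p / 2)]
    _ ≤ ∫⁻ x, ENNReal.ofReal (f x) ^ (2 : ℝ) * F.maxFun (N + m) (fun x => H x ^ (p / 2 - 1)) x ∂μ :=
        F.lintegral_sum_shiftSq_mul_le hD m hfm hf h0 N (by fun_prop)
    _ = ∫⁻ x, (ENNReal.ofReal (f x) ^ p) ^ (2 / p) *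
          (F.maxFun (N + m) (fun x => H x ^ (p / 2 - 1)) x ^ (p / (p - 2))) ^ (1 - 2 / p) ∂μ := by
        refine lintegral_congr fun x => ?_
        rw [← ENNReal.rpow_mul, ← ENNReal.rpow_mul]
        have e1 : p * (2 / p) = 2 := by field_simp
        have e2 : p / (p - 2) * (1 - 2 / p) = 1 := by field_simp
        rw [e1, e2, ENNReal.rpow_one]
    _ ≤ (∫⁻ x, ENNReal.ofReal (f x) ^ p ∂μ) ^ (2 / p) *
        (∫⁻ x, F.maxFun (N + m) (fun x => H x ^ (p / 2 - 1)) x ^ (p / (p - 2)) ∂μ) ^ (1 - 2 / p) :=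
        ENNReal.lintegral_mul_norm_pow_le (by fun_prop) (by fun_prop) (by positivity) hp1 (by ring)
    _ ≤ (∫⁻ x, ENNReal.ofReal (f x) ^ p ∂μ) ^ (2 / p) * (doobConst (p / (p - 2)) *
          ∫⁻ x, (H x ^ (p / 2 - 1)) ^ (p / (p - 2)) ∂μ) ^ (1 - 2 / p) := by
        gcongr
        exact F.lintegral_maxFun_rpow_le (N + m) (by fun_prop) hq
    _ = _ := by
        have e : (p / 2 - 1) * (p / (p - 2)) = p / 2 := by field_simp
        simp only [← ENNReal.rpow_mul, e]
        rw [ENNReal.mul_rpow_of_nonneg _ _ hp1]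
        ring

/-- The constant in the `L^p` bound for the square functions. -/
def squareConst (p : ℝ) (D : ℝ≥0) : ℝ≥0∞ :=
  if p ≤ 2 then (energyConst p D)⁻¹ ^ (p / 2) * doobConst p ^ (1 - p / 2)
  else (doobConst (p / (p - 2)) ^ (1 - 2 / p)) ^ (1 / (2 / p))

lemma squareConst_ne_top {p : ℝ} (hp : 1 < p) (hD : 1 ≤ D) : squareConst p D ≠ ∞ := by
  rw [squareConst]
  split_ifs with h
  · refine ENNReal.mul_ne_top (ENNReal.rpow_ne_top_of_nonneg (by linarith)
      (ENNReal.inv_ne_top.2 (energyConst_ne_zero hp hD)))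
      (ENNReal.rpow_ne_top_of_nonneg (by linarith) (doobConst_ne_top hp))
  · have hp2 : 0 < p - 2 := by linarith
    refine ENNReal.rpow_ne_top_of_nonneg (by positivity) (ENNReal.rpow_ne_top_of_nonneg ?_
      (doobConst_ne_top ?_))
    · rw [sub_nonneg, div_le_one (by linarith)]; linarith
    · rw [lt_div_iff₀ hp2]; linarith

/-- `L^p` bound for the square functions of averaged martingale differences, uniform in
the shift. -/
lemma lintegral_tsum_shiftSq_le {p : ℝ} (hp : 1 < p) (hD : 1 ≤ D) (m : ℕ)
    {f : X → ℝ} (hfm : Measurable f) (hf : Integrable f μ) (h0 : ∀ x, 0 ≤ f x)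
    (hfin : ∫⁻ x, ENNReal.ofReal (f x) ^ p ∂μ < ∞) :
    ∫⁻ x, (∑' k, F.shiftSq m f k x) ^ (p / 2) ∂μ ≤
      squareConst p D * ∫⁻ x, ENNReal.ofReal (f x) ^ p ∂μ := by
  have hs := F.measurable_shiftSq m f
  have hp0 : 0 ≤ p / 2 := by linarith
  have hlim := lintegral_tendsto_of_tendsto_of_monotone (μ := μ)
    (f := fun N x => (∑ k ∈ Finset.range N, F.shiftSq m f k x) ^ (p / 2))
    (F := fun x => (∑' k, F.shiftSq m f k x) ^ (p / 2)) (fun N => by fun_prop)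
    (ae_of_all _ fun x M N hMN => ENNReal.rpow_le_rpow (Finset.sum_le_sum_of_subset
      (Finset.range_mono hMN)) hp0)
    (ae_of_all _ fun x => (ENNReal.continuous_rpow_const.tendsto _).comp
      ENNReal.summable.hasSum.tendsto_sum_nat)
  refine le_of_tendsto' hlim fun N => ?_
  rw [squareConst]
  split_ifs with h
  · exact F.lintegral_sum_shiftSq_le_of_le_two hp h hD m hfm hf h0 N
  · exact F.lintegral_sum_shiftSq_le_of_two_lt (not_le.1 h) hD m hfm hf h0 hfin N

end CellFiltration

end IntrinsicMorrey

/-! ### Summation over the shifts -/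

namespace IntrinsicMorrey

/-- One factor τ^m pays for summing, the other stays inside: each τ^m c_m is at most the ℓ^r
quasi-norm. This is valid for every r > 0, so the triangle inequality in L^(p/2), which fails for p
< 2, is not needed. -/
lemma ENNReal_tsum_geometric_mul_rpow_le (τ : ℝ≥0∞) (c : ℕ → ℝ≥0∞) {r : ℝ} (hr : 0 < r) :
    (∑' m, τ ^ (2 * m) * c m) ^ r ≤ ((1 - τ)⁻¹) ^ r * ∑' m, (τ ^ m * c m) ^ r := by
  have h1 : ∀ m, τ ^ m * c m ≤ (∑' m, (τ ^ m * c m) ^ r) ^ (1 / r) := fun m => by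
    calc _ = ((τ ^ m * c m) ^ r) ^ (1 / r) := by
          rw [← ENNReal.rpow_mul, mul_one_div_cancel hr.ne', ENNReal.rpow_one]
      _ ≤ _ := by
          gcongr
          exact ENNReal.le_tsum (f := fun m => (τ ^ m * c m) ^ r) m
  calc _ ≤ (∑' m, τ ^ m * (∑' m, (τ ^ m * c m) ^ r) ^ (1 / r)) ^ r := by
        refine ENNReal.rpow_le_rpow (ENNReal.tsum_le_tsum fun m => ?_) hr.le
        rw [two_mul, pow_add, mul_assoc]
        gcongr
        exact h1 m
    _ = _ := by
        rw [ENNReal.tsum_mul_right, ENNReal.tsum_geometric, ENNReal.mul_rpow_of_nonneg _ _ hr.le,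
          ← ENNReal.rpow_mul, one_div_mul_cancel hr.ne', ENNReal.rpow_one]

namespace CellFiltration

variable {X : Type*} [MeasurableSpace X] {μ : Measure X} {ι : Type*} [MeasurableSpace ι] {D : ℝ≥0}
  (F : CellFiltration μ ι D)

/-- The dyadic square function dominating the intrinsic square function. -/
def geomSq (τ : ℝ≥0∞) (f : X → ℝ) (x : X) : ℝ≥0∞ :=
  ∑' k, (∑' m, τ ^ (2 * m) * F.lmean k (fun y => ‖F.diff (k + m) f y‖ₑ) x) ^ 2

/-- The constant in the `L^p` bound for `geomSq`. -/
def geomConst (p : ℝ) (D : ℝ≥0) (τ : ℝ≥0∞) : ℝ≥0∞ :=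
  ((1 - τ)⁻¹ ^ 2) ^ (p / 2) * ((1 - τ)⁻¹ ^ (p / 2) * ((1 - τ ^ (p / 2))⁻¹ * squareConst p D))

lemma geomConst_ne_top {p : ℝ} (hp : 1 < p) (hD : 1 ≤ D) {τ : ℝ≥0∞} (hτ : τ < 1) :
    geomConst p D τ ≠ ∞ := by
  have hp0 : 0 < p / 2 := by linarith
  have h1 : (1 - τ)⁻¹ ≠ ∞ := by simpa [tsub_eq_zero_iff_le] using hτ
  have h2 : (1 - τ ^ (p / 2))⁻¹ ≠ ∞ := by
    simpa [tsub_eq_zero_iff_le] using ENNReal.rpow_lt_one hτ hp0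
  exact ENNReal.mul_ne_top (ENNReal.rpow_ne_top_of_nonneg hp0.le (ENNReal.pow_ne_top h1))
    (ENNReal.mul_ne_top (ENNReal.rpow_ne_top_of_nonneg hp0.le h1)
      (ENNReal.mul_ne_top h2 (squareConst_ne_top hp hD)))

lemma geomSq_le (τ : ℝ≥0∞) (f : X → ℝ) (x : X) :
    F.geomSq τ f x ≤ (1 - τ)⁻¹ ^ 2 * ∑' m, τ ^ (2 * m) * ∑' k, F.shiftSq m f k x := by
  calc F.geomSq τ f x ≤ ∑' k, (1 - τ)⁻¹ ^ 2 * ∑' m, τ ^ (2 * m) * F.shiftSq m f k x := by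
        refine ENNReal.tsum_le_tsum fun k => ?_
        have := ENNReal_tsum_geometric_mul_rpow_le τ
          (fun m => F.lmean k (fun y => ‖F.diff (k + m) f y‖ₑ) x) two_pos
        simp only [ENNReal.rpow_two, mul_pow, ← pow_mul, mul_comm _ 2] at this
        exact this
    _ = _ := by
        rw [ENNReal.tsum_mul_left, ENNReal.tsum_comm]
        simp only [ENNReal.tsum_mul_left]

variable [Countable ι] [MeasurableSingletonClass ι]

lemma lintegral_geomSq_le {p : ℝ} (hp : 1 < p) (hD : 1 ≤ D) (τ : ℝ≥0∞)
    {f : X → ℝ} (hfm : Measurable f) (hf : Integrable f μ) (h0 : ∀ x, 0 ≤ f x)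
    (hfin : ∫⁻ x, ENNReal.ofReal (f x) ^ p ∂μ < ∞) :
    ∫⁻ x, F.geomSq τ f x ^ (p / 2) ∂μ ≤
      geomConst p D τ * ∫⁻ x, ENNReal.ofReal (f x) ^ p ∂μ := by
  have hp0 : 0 < p / 2 := by linarith
  have hs := F.measurable_shiftSq
  have hpt : ∀ x, F.geomSq τ f x ^ (p / 2) ≤ ((1 - τ)⁻¹ ^ 2) ^ (p / 2) * ((1 - τ)⁻¹ ^ (p / 2) *
      ∑' m, (τ ^ (p / 2)) ^ m * (∑' k, F.shiftSq m f k x) ^ (p / 2)) := fun x => by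
    refine (ENNReal.rpow_le_rpow (F.geomSq_le τ f x) hp0.le).trans ?_
    rw [ENNReal.mul_rpow_of_nonneg _ _ hp0.le]
    gcongr
    refine (ENNReal_tsum_geometric_mul_rpow_le τ _ hp0).trans_eq ?_
    congr! 3 with m
    rw [ENNReal.mul_rpow_of_nonneg _ _ hp0.le, ← ENNReal.rpow_natCast, ← ENNReal.rpow_natCast,
      ← ENNReal.rpow_mul, ← ENNReal.rpow_mul, mul_comm (p / 2)]
  calc _ ≤ _ := lintegral_mono hpt
    _ = ((1 - τ)⁻¹ ^ 2) ^ (p / 2) * ((1 - τ)⁻¹ ^ (p / 2) *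
        ∑' m, (τ ^ (p / 2)) ^ m * ∫⁻ x, (∑' k, F.shiftSq m f k x) ^ (p / 2) ∂μ) := by
        rw [lintegral_const_mul _ (by fun_prop), lintegral_const_mul _ (by fun_prop),
          lintegral_tsum fun m => by fun_prop]
        congr! 4 with m
        rw [lintegral_const_mul _ (by fun_prop)]
    _ ≤ ((1 - τ)⁻¹ ^ 2) ^ (p / 2) * ((1 - τ)⁻¹ ^ (p / 2) *
        ∑' m, (τ ^ (p / 2)) ^ m * (squareConst p D * ∫⁻ x, ENNReal.ofReal (f x) ^ p ∂μ)) := by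
        gcongr with m
        exact F.lintegral_tsum_shiftSq_le hp hD m hfm hf h0 hfin
    _ = _ := by
        rw [ENNReal.tsum_mul_right, ENNReal.tsum_geometric, geomConst]
        ring

end CellFiltration

end IntrinsicMorrey

/-! ### Translated dyadic grids and the one-third trick -/

namespace IntrinsicMorrey

lemma floor_eq_of_floor_two_mul_eq {z w : ℝ} (h : ⌊2 * z⌋ = ⌊2 * w⌋) : ⌊z⌋ = ⌊w⌋ := by
  have key : ∀ v : ℝ, ⌊v⌋ = ⌊2 * v⌋ / 2 := fun v => by
    rw [Int.floor_eq_iff]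
    have h1 := Int.floor_le (2 * v)
    have h2 := Int.lt_floor_add_one (2 * v)
    have h3 : 2 * (⌊2 * v⌋ / 2) ≤ ⌊2 * v⌋ := by omega
    have h4 : ⌊2 * v⌋ ≤ 2 * (⌊2 * v⌋ / 2) + 1 := by omega
    have h3' : (2 : ℝ) * ((⌊2 * v⌋ / 2 : ℤ) : ℝ) ≤ ⌊2 * v⌋ := by exact_mod_cast h3
    have h4' : (⌊2 * v⌋ : ℝ) ≤ 2 * ((⌊2 * v⌋ / 2 : ℤ) : ℝ) + 1 := by exact_mod_cast h4
    constructor <;> linarith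
  rw [key z, key w, h]

/-- The floor of the larger of the two points is an integer lying between them. -/
lemma exists_int_near_of_floor_ne {y z δ : ℝ} (h : |z - y| ≤ δ) (hne : ⌊z⌋ ≠ ⌊y⌋) :
    ∃ a : ℤ, |y - a| ≤ δ := by
  have h' := abs_le.1 h
  rcases lt_or_gt_of_ne hne with hlt | hlt
  · refine ⟨⌊y⌋, abs_le.2 ?_⟩
    have h1 := Int.floor_le y
    have h2 := Int.floor_lt.1 hlt
    constructor <;> linarith
  · refine ⟨⌊z⌋, abs_le.2 ?_⟩
    have h1 := Int.floor_le z
    have h2 := Int.floor_lt.1 hlt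
    constructor <;> linarith

/-- The one-third trick: an interval of length less than `1 / 3` does not meet both `ℤ` and its
translate by `2 ^ k / 3`. -/
lemma exists_shift_floor_eq (k : ℕ) (y δ : ℝ) (hδ : 6 * δ < 1) :
    ∃ b : Bool, ∀ z, |z - y| ≤ δ →
      ⌊z + (if b then (2 : ℝ) ^ k / 3 else 0)⌋ = ⌊y + (if b then (2 : ℝ) ^ k / 3 else 0)⌋ := by
  by_contra! hcon
  obtain ⟨z, hz, hne⟩ := hcon false
  obtain ⟨w, hw, hne'⟩ := hcon true
  simp only [Bool.false_eq_true, if_false, add_zero] at hne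
  simp only [if_true] at hne'
  obtain ⟨a, ha⟩ := exists_int_near_of_floor_ne hz hne
  obtain ⟨b, hb⟩ := exists_int_near_of_floor_ne (δ := δ)
    (by rwa [add_sub_add_right_eq_sub]) hne'
  rw [abs_le] at ha hb
  -- If both grids failed, y would be δ-close to a and y + 2^k / 3 to b, so 2^k - 3 (b - a) would be
  -- an integer of modulus at most 6 δ < 1, hence 0; but 3 does not divide 2^k.
  have h1 : (2 : ℝ) ^ k - 3 * (b - a) < 1 := by linarith
  have h2 : -1 < (2 : ℝ) ^ k - 3 * (b - a) := by linarith
  have h3 : (2 : ℤ) ^ k - 3 * (b - a) < 1 := by exact_mod_cast h1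
  have h4 : -1 < (2 : ℤ) ^ k - 3 * (b - a) := by exact_mod_cast h2
  have h5 : (3 : ℤ) ∣ 2 ^ k := ⟨b - a, by omega⟩
  have := Int.Prime.dvd_pow' Nat.prime_three h5
  omega

variable {n : ℕ}

/-- Labels of the half-open cubes of side `L / 2 ^ k` in a translated dyadic grid. -/
def dyadicLabel (L : ℝ) (s : Fin n → ℝ) (k : ℕ) (x : EuclideanSpace ℝ (Fin n)) : Fin n → ℤ :=
  fun i => ⌊2 ^ k / L * (x i + s i)⌋

lemma measurable_dyadicLabel (L : ℝ) (s : Fin n → ℝ) (k : ℕ) : Measurable (dyadicLabel L s k) := by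
  refine measurable_pi_lambda _ fun i => Int.measurable_floor.comp ?_
  fun_prop

lemma volume_dyadicLabel_fiber {L : ℝ} (hL : 0 < L) (s : Fin n → ℝ) (k : ℕ)
    (x : EuclideanSpace ℝ (Fin n)) :
    volume {y | dyadicLabel L s k y = dyadicLabel L s k x} = ENNReal.ofReal (L / 2 ^ k) ^ n := by
  have hc : 0 < 2 ^ k / L := by positivity
  have hset : {y | dyadicLabel L s k y = dyadicLabel L s k x} =
      (@WithLp.ofLp 2 (Fin n → ℝ)) ⁻¹' (univ.pi fun i =>
        Ico ((dyadicLabel L s k x i : ℝ) / (2 ^ k / L) - s i)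
          (((dyadicLabel L s k x i : ℝ) + 1) / (2 ^ k / L) - s i)) := by
    ext y
    simp only [mem_ofPred_eq, mem_preimage, Set.mem_pi, mem_univ, true_imp_iff, funext_iff, mem_Ico]
    refine forall_congr' fun i => ?_
    conv_lhs => lhs; rw [dyadicLabel]
    rw [Int.floor_eq_iff, sub_le_iff_le_add, div_le_iff₀ hc, lt_sub_iff_add_lt, lt_div_iff₀ hc,
      mul_comm (2 ^ k / L)]
  rw [hset, (PiLp.volume_preserving_ofLp (Fin n)).measure_preimage
    (MeasurableSet.univ_pi fun _ => measurableSet_Ico).nullMeasurableSet, Real.volume_pi_Ico]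
  have : ∀ i, ((dyadicLabel L s k x i : ℝ) + 1) / (2 ^ k / L) - s i -
      ((dyadicLabel L s k x i : ℝ) / (2 ^ k / L) - s i) = L / 2 ^ k := fun i => by
    field_simp; ring
  simp [this]

/-- A translated dyadic grid with largest cubes of side `L`. -/
def dyadicGrid {L : ℝ} (hL : 0 < L) (s : Fin n → ℝ) :
    CellFiltration (volume : Measure (EuclideanSpace ℝ (Fin n))) (Fin n → ℤ) (2 ^ n) where
  label := dyadicLabel L s
  measurable_label := measurable_dyadicLabel L s
  refines k x y h := by
    funext i
    refine floor_eq_of_floor_two_mul_eq ?_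
    have := congrFun h i
    simp only [dyadicLabel, pow_succ] at this
    convert this using 2 <;> ring
  measure_ne_zero k x := by
    rw [volume_dyadicLabel_fiber hL]
    exact pow_ne_zero _ (by simpa using by positivity)
  measure_ne_top k x := by
    rw [volume_dyadicLabel_fiber hL]
    exact ENNReal.pow_ne_top ENNReal.ofReal_ne_top
  doubling k x := by
    rw [volume_dyadicLabel_fiber hL, volume_dyadicLabel_fiber hL]
    push_cast
    rw [← mul_pow]
    refine le_of_eq ?_
    congr 1
    rw [← ENNReal.ofReal_ofNat, ← ENNReal.ofReal_mul zero_le_two]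
    congr 1
    rw [pow_succ]
    field_simp

lemma volume_cell_dyadicGrid {L : ℝ} (hL : 0 < L) (s : Fin n → ℝ) (k : ℕ)
    (x : EuclideanSpace ℝ (Fin n)) :
    volume ((dyadicGrid hL s).cell k x) = ENNReal.ofReal (L / 2 ^ k) ^ n :=
  volume_dyadicLabel_fiber hL s k x

lemma norm_sub_le_of_label_eq {L : ℝ} (hL : 0 < L) (s : Fin n → ℝ) (k : ℕ)
    {x y : EuclideanSpace ℝ (Fin n)}
    (h : (dyadicGrid hL s).label k x = (dyadicGrid hL s).label k y) :
    ‖x - y‖ ≤ √n * (L / 2 ^ k) := by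
  have hc : 0 < 2 ^ k / L := by positivity
  have hL' : 0 ≤ L / 2 ^ k := by positivity
  have hi : ∀ i, ‖(x - y) i‖ ^ 2 ≤ (L / 2 ^ k) ^ 2 := fun i => by
    have h1 := Int.abs_sub_lt_one_of_floor_eq_floor (congrFun h i)
    rw [← mul_sub, add_sub_add_right_eq_sub, abs_mul, abs_of_pos hc, mul_comm, ← lt_div_iff₀ hc,
      one_div_div] at h1
    rw [Real.norm_eq_abs]
    exact pow_le_pow_left₀ (abs_nonneg _) h1.le 2
  rw [EuclideanSpace.norm_eq, ← Real.sqrt_sq hL', ← Real.sqrt_mul (Nat.cast_nonneg n)]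
  refine Real.sqrt_le_sqrt ((Finset.sum_le_sum fun i _ => hi i).trans_eq (by simp))

/-- The translation vectors of the one-third trick. -/
def thirdShift (L : ℝ) (ω : Fin n → Bool) (i : Fin n) : ℝ := if ω i then L / 3 else 0

/-- Apply the one-third trick in each coordinate after rescaling to unit cubes. The translation is L
/ 3 in every generation, which keeps the grid nested; in units of the side L / 2^k it reads 2^k / 3.
-/
lemma exists_closedBall_subset_cell {L : ℝ} (hL : 0 < L) (k : ℕ) (x : EuclideanSpace ℝ (Fin n))
    {t : ℝ} (ht : 6 * t < L / 2 ^ k) :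
    ∃ ω, Metric.closedBall x t ⊆ (dyadicGrid hL (thirdShift L ω)).cell k x := by
  have hc : 0 < 2 ^ k / L := by positivity
  have hδ : 6 * (2 ^ k / L * t) < 1 := by
    rw [lt_div_iff₀ (by positivity)] at ht
    rw [← mul_assoc, mul_comm 6, mul_assoc, div_mul_eq_mul_div, div_lt_one hL]
    linarith
  choose ω hω using fun i => exists_shift_floor_eq k (2 ^ k / L * x i) (2 ^ k / L * t) hδ
  refine ⟨ω, fun z hz => funext fun i => ?_⟩
  have hzi : |z i - x i| ≤ t := by
    rw [Metric.mem_closedBall, dist_eq_norm] at hz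
    exact (PiLp.norm_apply_le (z - x) i).trans hz
  have h := hω i (2 ^ k / L * z i) (by
    rw [← mul_sub, abs_mul, abs_of_pos hc]
    gcongr)
  have e : 2 ^ k / L * thirdShift L ω i = if ω i then (2 : ℝ) ^ k / 3 else 0 := by
    rw [thirdShift]
    split_ifs
    · field_simp
    · simp
  rw [← e, ← mul_add, ← mul_add] at h
  exact h

end IntrinsicMorrey

/-! ### Pairing a smooth mean-zero function with a martingale expansion -/

namespace IntrinsicMorrey

namespace CellFiltration

variable {X : Type*} [MeasurableSpace X] {μ : Measure X} {ι : Type*} [MeasurableSpace ι] {D : ℝ≥0}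
  (F : CellFiltration μ ι D)

/-- A chosen point in the cell of generation `k` containing `x`. -/
def center [Nonempty X] (k : ℕ) (x : X) : X := Classical.epsilon fun y => F.label k y = F.label k x

lemma label_center [Nonempty X] (k : ℕ) (x : X) : F.label k (F.center k x) = F.label k x :=
  Classical.epsilon_spec (p := fun y => F.label k y = F.label k x) ⟨x, rfl⟩

lemma isConst_center [Nonempty X] (k : ℕ) : F.IsConst k (F.center k) := fun x y h => by
  simp only [center, h]

lemma setIntegral_mul_isConst [MeasurableSingletonClass ι] (k : ℕ) (f : X → ℝ) {V : X → ℝ}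
    (hV : F.IsConst k V) (x : X) :
    ∫ y in F.cell k x, f y * V y ∂μ = (∫ y in F.cell k x, f y ∂μ) * V x := by
  rw [setIntegral_congr_fun (g := fun y => f y * V x) (F.measurableSet_cell k x)
    (fun y hy => by simp only [hV y x hy]), integral_mul_const]

lemma setIntegral_mean [MeasurableSingletonClass ι] (k : ℕ) (f : X → ℝ) (x : X) :
    ∫ y in F.cell k x, F.mean k f y ∂μ = ∫ y in F.cell k x, f y ∂μ := by
  rw [setIntegral_congr_fun (g := fun _ => F.mean k f x) (F.measurableSet_cell k x)
    (fun y hy => F.isConst_mean k f y x hy), setIntegral_const, mean,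
    measure_smul_setAverage (s := F.cell k x) _ (F.measure_ne_top k x)]

variable [Countable ι] [MeasurableSingletonClass ι]

lemma lintegral_enorm_mean (k : ℕ) {f : X → ℝ} (hfm : Measurable f) (hf : Integrable f μ)
    (h0 : ∀ x, 0 ≤ f x) : ∫⁻ x, ‖F.mean k f x‖ₑ ∂μ = ∫⁻ x, ‖f x‖ₑ ∂μ := by
  have h1 : ∀ x, ‖F.mean k f x‖ₑ = F.lmean k (fun y => ENNReal.ofReal (f y)) x := fun x => by
    rw [Real.enorm_eq_ofReal (F.mean_nonneg k h0 x), F.ofReal_mean k hf h0]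
  have h2 : ∀ x, ‖f x‖ₑ = ENNReal.ofReal (f x) := fun x => Real.enorm_eq_ofReal (h0 x)
  simp only [h1, h2]
  exact F.lintegral_lmean k (by fun_prop)

lemma integrable_mean (k : ℕ) {f : X → ℝ} (hfm : Measurable f) (hf : Integrable f μ)
    (h0 : ∀ x, 0 ≤ f x) : Integrable (F.mean k f) μ :=
  ⟨(F.measurable_mean k f).aestronglyMeasurable, by
    rw [HasFiniteIntegral, F.lintegral_enorm_mean k hfm hf h0]; exact hf.2⟩

lemma integrable_diff (k : ℕ) {f : X → ℝ} (hfm : Measurable f) (hf : Integrable f μ)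
    (h0 : ∀ x, 0 ≤ f x) : Integrable (F.diff k f) μ :=
  (F.integrable_mean (k + 1) hfm hf h0).sub (F.integrable_mean k hfm hf h0)

lemma integral_mean_mul (k : ℕ) {f : X → ℝ} (hfm : Measurable f) (hf : Integrable f μ)
    (h0 : ∀ x, 0 ≤ f x) {V : X → ℝ} (hV : F.IsConst k V) {B : ℝ} (hB : ∀ x, |V x| ≤ B) :
    ∫ x, F.mean k f x * V x ∂μ = ∫ x, f x * V x ∂μ := by
  have hsum : ∀ g : X → ℝ, Integrable g μ →
      HasSum (fun i => ∫ x in F.label k ⁻¹' {i}, g x ∂μ) (∫ x, g x ∂μ) := fun g hg => by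
    have hU : (⋃ i, F.label k ⁻¹' {i}) = univ := by
      rw [← preimage_iUnion, iUnion_of_singleton, preimage_univ]
    have := hasSum_integral_iUnion (μ := μ) (f := g) (s := fun i => F.label k ⁻¹' {i})
      (fun i => F.measurable_label k (measurableSet_singleton i))
      (fun i j hij => Disjoint.preimage _ (by simpa using hij)) (by rw [hU]; exact hg.integrableOn)
    rwa [hU, setIntegral_univ] at this
  have hVm : AEStronglyMeasurable V μ := hV.measurable.aestronglyMeasurable
  have hb : ∀ᵐ x ∂μ, ‖V x‖ ≤ B := ae_of_all _ hB
  refine (hsum _ ((F.integrable_mean k hfm hf h0).mul_bdd hVm hb)).unique ?_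
  convert hsum _ (hf.mul_bdd hVm hb) using 2 with i
  rcases (F.label k ⁻¹' {i}).eq_empty_or_nonempty with he | ⟨x, hx⟩
  · simp [he]
  · have : F.label k ⁻¹' {i} = F.cell k x := by
      ext y; simp only [mem_preimage, mem_singleton_iff, cell, mem_ofPred_eq] at hx ⊢; rw [hx]
    rw [this, F.setIntegral_mul_isConst k _ hV, F.setIntegral_mul_isConst k _ hV,
      F.setIntegral_mean]

/-- Martingale differences are orthogonal to bounded functions of the coarser generation; this
allows a kernel to be replaced by its oscillation. -/
lemma integral_diff_mul (k : ℕ) {f : X → ℝ} (hfm : Measurable f) (hf : Integrable f μ)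
    (h0 : ∀ x, 0 ≤ f x) {V : X → ℝ} (hV : F.IsConst k V) {B : ℝ} (hB : ∀ x, |V x| ≤ B) :
    ∫ x, F.diff k f x * V x ∂μ = 0 := by
  have hVm : AEStronglyMeasurable V μ := hV.measurable.aestronglyMeasurable
  have hb : ∀ᵐ x ∂μ, ‖V x‖ ≤ B := ae_of_all _ hB
  simp only [diff, sub_mul]
  rw [integral_sub ((F.integrable_mean (k + 1) hfm hf h0).mul_bdd hVm hb)
    ((F.integrable_mean k hfm hf h0).mul_bdd hVm hb),
    F.integral_mean_mul (k + 1) hfm hf h0 (hV.mono k.le_succ) hB,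
    F.integral_mean_mul k hfm hf h0 hV hB,
    sub_self]

/-- Pairing of a function oscillating little on small cells, supported in a cell and with mean
zero, against `f`. Here `ε j` bounds the oscillation on the cells of generation `j`. -/
lemma enorm_integral_mul_le [Nonempty X] (k : ℕ) (x : X) {ψ : X → ℝ} (hψ : Measurable ψ) {B : ℝ}
    (hB : ∀ y, |ψ y| ≤ B) (hsupp : ∀ y, y ∉ F.cell k x → ψ y = 0) (hint : ∫ y, ψ y ∂μ = 0)
    {ε : ℕ → ℝ≥0} (hε : ∀ j y z, F.label j y = F.label j z → |ψ y - ψ z| ≤ ε j)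
    (hlim : Tendsto ε atTop (𝓝 0))
    {f : X → ℝ} (hfm : Measurable f) (hf : Integrable f μ) (h0 : ∀ x, 0 ≤ f x) :
    ‖∫ y, ψ y * f y ∂μ‖ₑ ≤ μ (F.cell k x) *
      ∑' m, ε (k + m) * F.lmean k (fun y => ‖F.diff (k + m) f y‖ₑ) x := by
  have hψm : AEStronglyMeasurable ψ μ := hψ.aestronglyMeasurable
  have hb : ∀ᵐ x ∂μ, ‖ψ x‖ ≤ B := ae_of_all _ hB
  have hmean := fun j => F.integrable_mean j hfm hf h0
  have hdiff := fun j => F.integrable_diff j hfm hf h0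
  have hosc : ∀ j y, ‖ψ y - ψ (F.center j y)‖ₑ ≤ ε j := fun j y => by
    rw [Real.enorm_eq_ofReal_abs, ← ENNReal.ofReal_coe_nnreal]
    exact ENNReal.ofReal_le_ofReal (hε j _ _ (F.label_center j y).symm)
  have hVc : ∀ j, F.IsConst j (fun y => ψ (F.center j y)) := fun j y z h => by
    simp only [F.isConst_center j y z h]
  have hVm : ∀ j, AEStronglyMeasurable (fun y => ψ (F.center j y)) μ := fun j =>
    (hVc j).measurable.aestronglyMeasurable
  have hVb : ∀ j, ∀ᵐ y ∂μ, ‖ψ (F.center j y)‖ ≤ B := fun j => ae_of_all _ fun y => hB _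
  have hterm : ∀ m, ‖∫ y, ψ y * F.diff (k + m) f y ∂μ‖ₑ ≤
      μ (F.cell k x) * (ε (k + m) * F.lmean k (fun y => ‖F.diff (k + m) f y‖ₑ) x) := by
    intro m
    -- Subtracting the value of ψ at the centre of each cell of generation k + m does not change the
    -- pairing.
    have h1 : ∫ y, ψ y * F.diff (k + m) f y ∂μ =
        ∫ y, (ψ y - ψ (F.center (k + m) y)) * F.diff (k + m) f y ∂μ := by
      simp only [sub_mul]
      rw [integral_sub ((hdiff _).bdd_mul hψm hb) ((hdiff _).bdd_mul (hVm _) (hVb _))]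
      simp only [mul_comm (ψ (F.center _ _))]
      rw [F.integral_diff_mul (k + m) hfm hf h0 (hVc _) (fun y => hB _), sub_zero]
    rw [h1]
    calc _ ≤ ∫⁻ y, ‖(ψ y - ψ (F.center (k + m) y)) * F.diff (k + m) f y‖ₑ ∂μ :=
          enorm_integral_le_lintegral_enorm _
      _ ≤ ∫⁻ y, (F.cell k x).indicator (fun y => ε (k + m) * ‖F.diff (k + m) f y‖ₑ) y ∂μ := by
          refine lintegral_mono fun y => ?_
          by_cases hy : y ∈ F.cell k x
          · rw [indicator_of_mem hy, enorm_mul]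
            gcongr
            exact hosc _ y
          -- The centre lies in the same cell of generation k as y, so discretizing ψ does not
          -- enlarge its support beyond the cell of x.
          · have hy' : F.center (k + m) y ∉ F.cell k x := fun h => hy
              ((F.label_of_le (Nat.le_add_right k m) (F.label_center (k + m) y)).symm.trans h)
            rw [hsupp y hy, hsupp _ hy']
            simp
      _ = ε (k + m) * ∫⁻ y in F.cell k x, ‖F.diff (k + m) f y‖ₑ ∂μ := by
          rw [lintegral_indicator (F.measurableSet_cell k x),
            lintegral_const_mul _ (F.measurable_diff _ _).enorm]
      _ = _ := by rw [← F.measure_mul_lmean]; ring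
  have hzero : ∫ y, ψ y * F.mean k f y ∂μ = 0 := by
    have : ∀ y, ψ y * F.mean k f y = ψ y * F.mean k f x := fun y => by
      by_cases hy : y ∈ F.cell k x
      · rw [F.isConst_mean k f y x hy]
      · rw [hsupp y hy, zero_mul, zero_mul]
    simp only [this, integral_mul_const, hint, zero_mul]
  have htele : ∀ M, ∫ y, ψ y * F.mean (k + M) f y ∂μ =
      ∑ m ∈ Finset.range M, ∫ y, ψ y * F.diff (k + m) f y ∂μ := by
    intro M
    induction M with
    | zero => simpa using hzero
    | succ M ih =>
      rw [Finset.sum_range_succ, ← ih, ← integral_add ((hmean _).bdd_mul hψm hb)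
        ((hdiff _).bdd_mul hψm hb)]
      refine integral_congr_ae (ae_of_all _ fun y => ?_)
      simp only [diff, add_assoc]
      ring
  -- Since f - E_j f is orthogonal to the discretized ψ, the remainder is at most ε_j times twice
  -- the L¹ norm of f. Convergence thus comes from the regularity of ψ, and no martingale
  -- convergence theorem is used.
  have herr : ∀ M, ‖∫ y, ψ y * f y ∂μ - ∫ y, ψ y * F.mean (k + M) f y ∂μ‖ₑ ≤
      ε (k + M) * (2 * ∫⁻ y, ‖f y‖ₑ ∂μ) := by
    intro M
    set j := k + M
    have h1 : ∫ y, ψ y * f y ∂μ - ∫ y, ψ y * F.mean j f y ∂μ =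
        ∫ y, (ψ y - ψ (F.center j y)) * (f y - F.mean j f y) ∂μ := by
      have h2 := F.integral_mean_mul j hfm hf h0 (hVc j) (fun y => hB _)
      have e : ∀ y, (ψ y - ψ (F.center j y)) * (f y - F.mean j f y) =
          (ψ y * f y - ψ y * F.mean j f y) -
            (f y * ψ (F.center j y) - F.mean j f y * ψ (F.center j y)) := fun y => by ring
      simp only [e]
      have i1 : Integrable (fun y => ψ y * f y - ψ y * F.mean j f y) μ :=
        (hf.bdd_mul hψm hb).sub ((hmean j).bdd_mul hψm hb)
      have i2 : Integrable (fun y => f y * ψ (F.center j y) - F.mean j f y * ψ (F.center j y)) μ :=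
        (hf.mul_bdd (hVm j) (hVb j)).sub ((hmean j).mul_bdd (hVm j) (hVb j))
      rw [integral_sub i1 i2,
        integral_sub (hf.bdd_mul hψm hb) ((hmean j).bdd_mul hψm hb),
        integral_sub (hf.mul_bdd (hVm j) (hVb j)) ((hmean j).mul_bdd (hVm j) (hVb j)), h2]
      ring
    rw [h1]
    calc _ ≤ ∫⁻ y, ‖(ψ y - ψ (F.center j y)) * (f y - F.mean j f y)‖ₑ ∂μ :=
          enorm_integral_le_lintegral_enorm _
      _ ≤ ∫⁻ y, ε j * (‖f y‖ₑ + ‖F.mean j f y‖ₑ) ∂μ := by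
          refine lintegral_mono fun y => ?_
          rw [enorm_mul]
          gcongr
          · exact hosc j y
          · exact enorm_sub_le
      _ = _ := by
          rw [lintegral_const_mul _ (by have := F.measurable_mean j f; fun_prop),
            lintegral_add_left hfm.enorm, F.lintegral_enorm_mean j hfm hf h0, two_mul]
  have hbound : ∀ M, ‖∫ y, ψ y * f y ∂μ‖ₑ ≤ ε (k + M) * (2 * ∫⁻ y, ‖f y‖ₑ ∂μ) +
      μ (F.cell k x) * ∑' m, ε (k + m) * F.lmean k (fun y => ‖F.diff (k + m) f y‖ₑ) x := by
    intro M
    rw [← sub_add_cancel (∫ y, ψ y * f y ∂μ) (∫ y, ψ y * F.mean (k + M) f y ∂μ)]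
    refine (enorm_add_le _ _).trans (add_le_add (herr M) ?_)
    rw [htele M, ← ENNReal.tsum_mul_left]
    exact (enorm_sum_le _ _).trans ((Finset.sum_le_sum fun m _ => hterm m).trans
      (ENNReal.sum_le_tsum _))
  have hfin : (2 * ∫⁻ y, ‖f y‖ₑ ∂μ) ≠ ∞ := ENNReal.mul_ne_top (by simp) hf.2.ne
  have hl : Tendsto (fun M => (ε (k + M) : ℝ≥0∞) * (2 * ∫⁻ y, ‖f y‖ₑ ∂μ) +
      μ (F.cell k x) * ∑' m, ε (k + m) * F.lmean k (fun y => ‖F.diff (k + m) f y‖ₑ) x) atTop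
      (𝓝 (0 * (2 * ∫⁻ y, ‖f y‖ₑ ∂μ) + μ (F.cell k x) *
        ∑' m, ε (k + m) * F.lmean k (fun y => ‖F.diff (k + m) f y‖ₑ) x)) := by
    refine Tendsto.add (ENNReal.Tendsto.mul_const ?_ (Or.inr hfin)) tendsto_const_nhds
    have : Tendsto (fun M => k + M) atTop atTop := tendsto_atTop_mono (fun M => Nat.le_add_left M k)
      tendsto_id
    exact ENNReal.tendsto_coe.2 (hlim.comp this)
  rw [zero_mul, zero_add] at hl
  exact ge_of_tendsto' hl hbound

end CellFiltration

end IntrinsicMorrey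

/-! ### Admissible kernels and measurability -/

namespace IntrinsicMorrey

variable {n : ℕ} {α : ℝ} {φ : EuclideanSpace ℝ (Fin n) → ℝ}

lemma IsAdmissible.continuous (h : IsAdmissible α φ) (hα : 0 < α) : Continuous φ := by
  refine continuous_iff_continuousAt.2 fun x => ?_
  rw [ContinuousAt, tendsto_iff_norm_sub_tendsto_zero]
  refine squeeze_zero (fun _ => norm_nonneg _) (fun y => h.holder y x) ?_
  have : Continuous fun y => ‖y - x‖ ^ α :=
    (continuous_id.sub continuous_const).norm.rpow_const fun _ => Or.inr hα.le
  simpa [Real.zero_rpow hα.ne'] using this.tendsto x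

lemma IsAdmissible.eq_zero (h : IsAdmissible α φ) {x : EuclideanSpace ℝ (Fin n)} (hx : 1 < ‖x‖) :
    φ x = 0 := by
  by_contra hne
  have := h.support_subset hne
  rw [Metric.mem_closedBall, dist_zero_right] at this
  linarith

/-- Compare with a point of norm 2, where φ vanishes; it is at distance at most 3. Such a point
exists because n > 0. -/
lemma IsAdmissible.abs_le (h : IsAdmissible α φ) (hα : 0 < α) (hα1 : α ≤ 1) (hn : 0 < n)
    (x : EuclideanSpace ℝ (Fin n)) : |φ x| ≤ 3 := by
  rcases lt_or_ge 1 ‖x‖ with hx | hx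
  · rw [h.eq_zero hx]; norm_num
  have : Nonempty (Fin n) := ⟨⟨0, hn⟩⟩
  obtain ⟨y, hy⟩ := _root_.exists_norm_eq (EuclideanSpace ℝ (Fin n)) (zero_le_two (α := ℝ))
  have hxy : ‖x - y‖ ≤ 3 := (norm_sub_le _ _).trans (by linarith)
  calc |φ x| = |φ x - φ y| := by rw [h.eq_zero (x := y) (by linarith), sub_zero]
    _ ≤ ‖x - y‖ ^ α := h.holder x y
    _ ≤ 3 ^ α := Real.rpow_le_rpow (norm_nonneg _) hxy hα.le
    _ ≤ 3 ^ (1 : ℝ) := Real.rpow_le_rpow_of_exponent_le (by norm_num) hα1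
    _ = 3 := Real.rpow_one 3

lemma dilate_eq_zero {t : ℝ} (ht : 0 < t) (h : IsAdmissible α φ)
    {x z : EuclideanSpace ℝ (Fin n)}
    (hz : z ∉ Metric.closedBall x t) : dilate φ t (x - z) = 0 := by
  rw [dilate, h.eq_zero, mul_zero]
  rw [Metric.mem_closedBall, dist_comm, dist_eq_norm, not_le] at hz
  rwa [norm_smul, norm_inv, Real.norm_of_nonneg ht.le, inv_mul_eq_div, one_lt_div ht]

lemma abs_dilate_le {t : ℝ} (ht : 0 < t) (h : IsAdmissible α φ) (hα : 0 < α)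
    (hα1 : α ≤ 1) (hn : 0 < n) (x : EuclideanSpace ℝ (Fin n)) : |dilate φ t x| ≤ (t ^ n)⁻¹ * 3 := by
  rw [dilate, abs_mul, abs_of_pos (by positivity)]
  gcongr
  exact h.abs_le hα hα1 hn _

lemma abs_dilate_sub_le {t : ℝ} (ht : 0 < t) (h : IsAdmissible α φ) (hα : 0 < α)
    (x z z' : EuclideanSpace ℝ (Fin n))
    {d : ℝ} (hd : ‖z - z'‖ ≤ d) :
    |dilate φ t (x - z) - dilate φ t (x - z')| ≤ (t ^ n)⁻¹ * (d / t) ^ α := by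
  rw [dilate, dilate, ← mul_sub, abs_mul, abs_of_pos (by positivity)]
  gcongr
  refine (h.holder _ _).trans (Real.rpow_le_rpow (norm_nonneg _) ?_ hα.le)
  rw [← smul_sub, norm_smul, norm_inv, Real.norm_of_nonneg ht.le, inv_mul_eq_div,
    sub_sub_sub_cancel_left, norm_sub_rev]
  gcongr

lemma integral_dilate (t : ℝ) (h : IsAdmissible α φ) (x : EuclideanSpace ℝ (Fin n)) :
    ∫ z, dilate φ t (x - z) = 0 := by
  rw [integral_sub_left_eq_self (fun z => dilate φ t z) volume x]
  simp only [dilate]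
  rw [integral_const_mul, Measure.integral_comp_smul, h.integral_eq_zero, smul_zero, mul_zero]

lemma continuous_dilate (h : IsAdmissible α φ) (hα : 0 < α) (t : ℝ) : Continuous (dilate φ t) := by
  have := h.continuous hα
  unfold dilate
  fun_prop

variable {𝕜 : Type*} [RCLike 𝕜]

lemma continuousOn_conv (h : IsAdmissible α φ) (hα : 0 < α) (hα1 : α ≤ 1) (hn : 0 < n)
    {f : EuclideanSpace ℝ (Fin n) → 𝕜} (hf : LocallyIntegrable f) :
    ContinuousOn (fun q : EuclideanSpace ℝ (Fin n) × ℝ => ∫ z, dilate φ q.2 (q.1 - z) • f z)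
      {q | 0 < q.2} := by
  rintro ⟨x, t⟩ (ht : 0 < t)
  refine ContinuousAt.continuousWithinAt ?_
  have hev : ∀ᶠ q : EuclideanSpace ℝ (Fin n) × ℝ in 𝓝 (x, t),
      dist q.1 x < 1 ∧ t / 2 < q.2 ∧ q.2 < 2 * t := by
    refine (continuous_fst.tendsto (x, t)).eventually (Metric.ball_mem_nhds x one_pos) |>.and ?_
    exact ((continuous_snd.tendsto (x, t)).eventually (lt_mem_nhds (by simpa using by linarith))).and
      ((continuous_snd.tendsto (x, t)).eventually (gt_mem_nhds (by simpa using by linarith)))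
  have hφ := h.continuous hα
  -- For centres within 1 of x and scales between t / 2 and 2 t, all kernels live in this ball and
  -- are at most 3 (t / 2)^(-n).
  set K := Metric.closedBall x (2 * t + 1) with hK
  refine continuousAt_of_dominated
    (bound := fun z => K.indicator (fun z => ((t / 2) ^ n)⁻¹ * 3 * ‖f z‖) z) ?_ ?_ ?_ ?_
  · refine Eventually.of_forall fun q => ?_
    have := continuous_dilate h hα q.2
    exact (this.comp (continuous_const.sub continuous_id)).aestronglyMeasurable.smul
      hf.aestronglyMeasurable
  · filter_upwards [hev] with q hq
    refine ae_of_all _ fun z => ?_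
    have hq2 : 0 < q.2 := by linarith [hq.2.1]
    by_cases hz : z ∈ K
    · rw [indicator_of_mem hz, norm_smul]
      gcongr
      refine (abs_dilate_le hq2 h hα hα1 hn _).trans ?_
      gcongr
      exact hq.2.1.le
    · rw [dilate_eq_zero hq2 h, zero_smul, norm_zero, indicator_of_notMem hz]
      intro hz'
      refine hz ?_
      rw [Metric.mem_closedBall] at hz' ⊢
      linarith [dist_triangle z q.1 x, hq.1, hq.2.2]
  · rw [integrable_indicator_iff Metric.isClosed_closedBall.measurableSet]
    exact ((hf.integrableOn_isCompact (isCompact_closedBall x _)).norm).const_mul _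
  · refine ae_of_all _ fun z => ?_
    have : ContinuousAt (fun q : EuclideanSpace ℝ (Fin n) × ℝ => dilate φ q.2 (q.1 - z)) (x, t) := by
      unfold dilate
      refine ContinuousAt.mul ?_ (hφ.continuousAt.comp ?_)
      · exact (continuous_snd.continuousAt.pow n).inv₀ (pow_ne_zero n ht.ne')
      · exact (continuous_snd.continuousAt.inv₀ ht.ne').smul
          (continuous_fst.continuousAt.sub continuousAt_const)
    exact this.smul continuousAt_const

/-- The supremum is over an uncountable family, but each member is continuous in (x, t), so the
superlevel sets are open in the upper half-space. -/
lemma measurable_supConv (hα : 0 < α) (hα1 : α ≤ 1) (hn : 0 < n)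
    {f : EuclideanSpace ℝ (Fin n) → 𝕜} (hf : LocallyIntegrable f) :
    Measurable (fun q : EuclideanSpace ℝ (Fin n) × ℝ =>
      {q : EuclideanSpace ℝ (Fin n) × ℝ | 0 < q.2}.indicator (fun q => supConv α f q.1 q.2) q) := by
  have hopen : IsOpen {q : EuclideanSpace ℝ (Fin n) × ℝ | 0 < q.2} :=
    isOpen_lt continuous_const continuous_snd
  refine measurable_of_Ioi fun c => IsOpen.measurableSet ?_
  have hset : (fun q : EuclideanSpace ℝ (Fin n) × ℝ =>
      {q : EuclideanSpace ℝ (Fin n) × ℝ | 0 < q.2}.indicator (fun q => supConv α f q.1 q.2) q) ⁻¹'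
        Ioi c = ⋃ φ : {φ : EuclideanSpace ℝ (Fin n) → ℝ // IsAdmissible α φ},
          {q : EuclideanSpace ℝ (Fin n) × ℝ | 0 < q.2} ∩
            (fun q => ‖∫ z, dilate φ.1 q.2 (q.1 - z) • f z‖ₑ) ⁻¹' Ioi c := by
    ext q
    simp only [mem_preimage, mem_Ioi, mem_iUnion, mem_inter_iff, mem_ofPred_eq, exists_and_left]
    by_cases hq : 0 < q.2
    · rw [indicator_of_mem (by exact hq)]
      simp only [supConv, lt_iSup_iff, hq, true_and, Subtype.exists, exists_prop]
    · rw [indicator_of_notMem (by exact hq)]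
      simp [hq]
  rw [hset]
  exact isOpen_iUnion fun φ =>
    (continuousOn_conv φ.2 hα hα1 hn hf).enorm.isOpen_inter_preimage hopen isOpen_Ioi

lemma measurable_lintegral_supConv (hα : 0 < α) (hα1 : α ≤ 1) (hn : 0 < n)
    {f : EuclideanSpace ℝ (Fin n) → 𝕜} (hf : LocallyIntegrable f) {T : Set ℝ}
    (hT : MeasurableSet T) (hpos : T ⊆ Ioi 0) :
    Measurable fun x => ∫⁻ t in T, supConv α f x t ^ (2 : ℕ) / ENNReal.ofReal t := by
  have hm := measurable_supConv hα hα1 hn hf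
  have h2 : Measurable fun q : EuclideanSpace ℝ (Fin n) × ℝ =>
      ({q : EuclideanSpace ℝ (Fin n) × ℝ | 0 < q.2}.indicator
        (fun q => supConv α f q.1 q.2) q) ^ 2 / ENNReal.ofReal q.2 := by
    fun_prop
  have h3 := h2.lintegral_prod_right' (ν := volume.restrict T)
  convert h3 using 2 with x
  refine setLIntegral_congr_fun hT fun t ht => ?_
  simp only
  rw [indicator_of_mem (show (x, t) ∈ {q : EuclideanSpace ℝ (Fin n) × ℝ | 0 < q.2} from hpos ht)]

lemma measurable_gFun (hα : 0 < α) (hα1 : α ≤ 1) (hn : 0 < n)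
    {f : EuclideanSpace ℝ (Fin n) → 𝕜} (hf : LocallyIntegrable f) : Measurable (gFun α f) :=
  (measurable_lintegral_supConv hα hα1 hn hf measurableSet_Ioi le_rfl).pow_const _

end IntrinsicMorrey

/-! ### Domination by dyadic square functions, and L^p for nonnegative functions -/

namespace IntrinsicMorrey

variable {n : ℕ} {α : ℝ}

/-- The square root of the gain per generation. -/
def decay (α : ℝ) : ℝ≥0∞ := ENNReal.ofReal (2 ^ (-(α / 2)))

lemma decay_lt_one (hα : 0 < α) : decay α < 1 := by
  rw [decay, ENNReal.ofReal_lt_one]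
  exact Real.rpow_lt_one_of_one_lt_of_neg one_lt_two (by linarith)

/-- The constant in the pointwise domination by dyadic square functions. -/
def gridConst (n : ℕ) (α : ℝ) : ℝ≥0∞ := ENNReal.ofReal (14 ^ n * (√n * 14) ^ α)

/-- The kernel is supported in a cell of side ℓ ≤ 14 t, and on cells of side ℓ / 2^m it oscillates
by at most t^(-n) (√n ℓ / (2^m t))^α. The volume ℓ^n offsets t^(-n), and 2^(-αm) is `decay α ^ (2 *
m)`. -/
lemma enorm_conv_le {L : ℝ} (hL : 0 < L) (hα : 0 < α) (hα1 : α ≤ 1) (hn : 0 < n)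
    {f : EuclideanSpace ℝ (Fin n) → ℝ} (hfm : Measurable f) (hf : Integrable f)
    (h0 : ∀ x, 0 ≤ f x) (k : ℕ) (x : EuclideanSpace ℝ (Fin n)) {t : ℝ} (ht : 0 < t)
    (ht' : L / 2 ^ k ≤ 14 * t) {s : Fin n → ℝ}
    (hsub : Metric.closedBall x t ⊆ (dyadicGrid hL s).cell k x)
    {φ : EuclideanSpace ℝ (Fin n) → ℝ} (hφ : IsAdmissible α φ) :
    ‖∫ z, dilate φ t (x - z) • f z‖ₑ ≤ gridConst n α * ∑' m, decay α ^ (2 * m) *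
      (dyadicGrid hL s).lmean k (fun y => ‖(dyadicGrid hL s).diff (k + m) f y‖ₑ) x := by
  set F := dyadicGrid hL s with hF
  have hcont : Continuous fun z => dilate φ t (x - z) :=
    (continuous_dilate hφ hα t).comp (continuous_const.sub continuous_id)
  have hlim : Tendsto (fun j : ℕ => ((t ^ n)⁻¹ * (√n * (L / 2 ^ j) / t) ^ α).toNNReal) atTop
      (𝓝 0) := by
    rw [← Real.toNNReal_zero]
    refine (continuous_real_toNNReal.tendsto _).comp ?_
    have h1 : Tendsto (fun j : ℕ => L / 2 ^ j) atTop (𝓝 0) :=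
      tendsto_const_nhds.div_atTop (tendsto_pow_atTop_atTop_of_one_lt one_lt_two)
    have h2 : Tendsto (fun j : ℕ => (t ^ n)⁻¹ * (√n * (L / 2 ^ j) / t) ^ α) atTop
        (𝓝 ((t ^ n)⁻¹ * (√n * 0 / t) ^ α)) :=
      (((h1.const_mul _).div_const t).rpow_const (Or.inr hα.le)).const_mul _
    simpa [Real.zero_rpow hα.ne'] using h2
  have key := F.enorm_integral_mul_le k x hcont.measurable
    (fun y => abs_dilate_le ht hφ hα hα1 hn (x - y))
    (fun y hy => dilate_eq_zero ht hφ fun h => hy (hsub h)) (integral_dilate t hφ x)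
    (fun j y z hyz => (abs_dilate_sub_le ht hφ hα x y z
      (norm_sub_le_of_label_eq hL s j hyz)).trans (Real.le_coe_toNNReal _)) hlim hfm hf h0
  simp only [smul_eq_mul]
  refine key.trans ?_
  rw [← ENNReal.tsum_mul_left, ← ENNReal.tsum_mul_left]
  refine ENNReal.tsum_le_tsum fun m => ?_
  rw [← mul_assoc, ← mul_assoc]
  refine mul_le_mul' ?_ le_rfl
  rw [hF, volume_cell_dyadicGrid, decay, gridConst]
  -- The oscillation bound enters as the coercion of a `Real.toNNReal`, which is `ENNReal.ofReal` by
  -- definition.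
  change _ * ENNReal.ofReal _ ≤ _
  rw [← ENNReal.ofReal_pow (by positivity), ← ENNReal.ofReal_pow (by positivity),
    ← ENNReal.ofReal_mul (by positivity), ← ENNReal.ofReal_mul (by positivity)]
  refine ENNReal.ofReal_le_ofReal ?_
  set ℓ := L / 2 ^ k with hℓ
  have hℓ0 : 0 < ℓ := by positivity
  have e1 : √n * (L / 2 ^ (k + m)) / t = √n * (ℓ / t) * (1 / 2 ^ m) := by
    rw [hℓ, pow_add]; field_simp
  have e2 : (1 / 2 ^ m : ℝ) ^ α = ((2 : ℝ) ^ (-(α / 2))) ^ (2 * m) := by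
    rw [one_div, ← Real.rpow_natCast 2 m, ← Real.rpow_neg zero_le_two, ← Real.rpow_mul zero_le_two,
      ← Real.rpow_natCast _ (2 * m), ← Real.rpow_mul zero_le_two]
    congr 1
    push_cast
    ring
  have e3 : ℓ / t ≤ 14 := (div_le_iff₀ ht).2 ht'
  calc ℓ ^ n * ((t ^ n)⁻¹ * (√n * (L / 2 ^ (k + m)) / t) ^ α)
      = (ℓ / t) ^ n * (√n * (ℓ / t)) ^ α * ((2 : ℝ) ^ (-(α / 2))) ^ (2 * m) := by
        rw [e1, Real.mul_rpow (by positivity) (by positivity), e2, div_pow]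
        ring
    _ ≤ _ := by gcongr

/-- The suitable grid depends on x and t, hence the sum over all translations. -/
lemma supConv_sq_le {L : ℝ} (hL : 0 < L) (hα : 0 < α) (hα1 : α ≤ 1) (hn : 0 < n)
    {f : EuclideanSpace ℝ (Fin n) → ℝ} (hfm : Measurable f) (hf : Integrable f)
    (h0 : ∀ x, 0 ≤ f x) (k : ℕ) (x : EuclideanSpace ℝ (Fin n)) {t : ℝ} (ht : 0 < t)
    (ht' : L / 2 ^ k ≤ 14 * t) (ht6 : 6 * t < L / 2 ^ k) :
    supConv α f x t ^ 2 ≤ gridConst n α ^ 2 * ∑ ω : Fin n → Bool, (∑' m, decay α ^ (2 * m) *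
      (dyadicGrid hL (thirdShift L ω)).lmean k
        (fun y => ‖(dyadicGrid hL (thirdShift L ω)).diff (k + m) f y‖ₑ) x) ^ 2 := by
  obtain ⟨ω, hω⟩ := exists_closedBall_subset_cell hL k x ht6
  have hle : supConv α f x t ≤ gridConst n α * ∑' m, decay α ^ (2 * m) *
      (dyadicGrid hL (thirdShift L ω)).lmean k
        (fun y => ‖(dyadicGrid hL (thirdShift L ω)).diff (k + m) f y‖ₑ) x :=
    iSup₂_le fun φ hφ => enorm_conv_le hL hα hα1 hn hfm hf h0 k x ht ht' hω hφ
  refine (pow_le_pow_left₀ zero_le hle 2).trans ?_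
  rw [mul_pow]
  exact mul_le_mul' le_rfl <| Finset.single_le_sum (f := fun ω => (∑' m, decay α ^ (2 * m) *
          (dyadicGrid hL (thirdShift L ω)).lmean k
          (fun y => ‖(dyadicGrid hL (thirdShift L ω)).diff (k + m) f y‖ₑ) x) ^ 2)
          (fun _ _ => zero_le) (Finset.mem_univ ω)

lemma lintegral_Ioc_div_le {a : ℝ} (ha : 0 < a) (c : ℝ≥0∞) :
    ∫⁻ t in Ioc a (2 * a), c / ENNReal.ofReal t ≤ c := by
  calc _ ≤ ∫⁻ t in Ioc a (2 * a), c / ENNReal.ofReal a :=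
        setLIntegral_mono' measurableSet_Ioc fun t ht => by
          gcongr
          exact ht.1.le
    _ = c := by
        rw [setLIntegral_const, Real.volume_Ioc, two_mul, add_sub_cancel_right]
        exact ENNReal.div_mul_cancel (by simpa using ha) ENNReal.ofReal_ne_top

lemma lintegral_Ioo_supConv_le {L : ℝ} (hL : 0 < L) (hα : 0 < α) (hα1 : α ≤ 1) (hn : 0 < n)
    {f : EuclideanSpace ℝ (Fin n) → ℝ} (hfm : Measurable f) (hf : Integrable f)
    (h0 : ∀ x, 0 ≤ f x) (x : EuclideanSpace ℝ (Fin n)) :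
    ∫⁻ t in Ioo 0 (L / 7), supConv α f x t ^ (2 : ℕ) / ENNReal.ofReal t ≤
      gridConst n α ^ 2 * ∑ ω : Fin n → Bool,
        (dyadicGrid hL (thirdShift L ω)).geomSq (decay α) f x := by
  -- With ℓ = L / 2^k, the window ℓ / 14 < t ≤ ℓ / 7 is dyadic and leaves room for 6 t < ℓ, as the
  -- one-third trick demands.
  have hcover : Ioo 0 (L / 7) ⊆ ⋃ k : ℕ, Ioc (L / 2 ^ k / 14) (2 * (L / 2 ^ k / 14)) := by
    rintro t ⟨ht, ht'⟩
    obtain ⟨k, hk1, hk2⟩ := exists_nat_pow_near (x := L / (7 * t)) (y := 2)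
      (by rw [one_le_div (by positivity)]; linarith) one_lt_two
    refine mem_iUnion.2 ⟨k, ?_⟩
    rw [le_div_iff₀ (by positivity)] at hk1
    rw [div_lt_iff₀ (by positivity), pow_succ] at hk2
    constructor
    · rw [div_div, div_lt_iff₀ (by positivity)]
      linarith
    · rw [div_div, ← mul_div_assoc, le_div_iff₀ (by positivity)]
      linarith
  calc _ ≤ ∫⁻ t in ⋃ k : ℕ, Ioc (L / 2 ^ k / 14) (2 * (L / 2 ^ k / 14)),
        supConv α f x t ^ (2 : ℕ) / ENNReal.ofReal t := lintegral_mono_set hcover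
    _ ≤ ∑' k : ℕ, ∫⁻ t in Ioc (L / 2 ^ k / 14) (2 * (L / 2 ^ k / 14)),
        supConv α f x t ^ (2 : ℕ) / ENNReal.ofReal t := lintegral_iUnion_le _ _
    _ ≤ ∑' k : ℕ, gridConst n α ^ 2 * ∑ ω : Fin n → Bool, (∑' m, decay α ^ (2 * m) *
      (dyadicGrid hL (thirdShift L ω)).lmean k
        (fun y => ‖(dyadicGrid hL (thirdShift L ω)).diff (k + m) f y‖ₑ) x) ^ 2 := by
        refine ENNReal.tsum_le_tsum fun k => ?_
        have hk : 0 < L / 2 ^ k := by positivity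
        refine le_trans (setLIntegral_mono' measurableSet_Ioc fun t ht => ?_)
          (lintegral_Ioc_div_le (a := L / 2 ^ k / 14) (by positivity) _)
        have ht0 : 0 < t := lt_trans (by positivity) ht.1
        gcongr
        exact supConv_sq_le hL hα hα1 hn hfm hf h0 k x ht0 (by linarith [ht.1])
          (by linarith [ht.2])
    _ = _ := by
        rw [ENNReal.tsum_mul_left, Summable.tsum_finsetSum fun _ _ => ENNReal.summable]
        rfl

lemma finset_sum_rpow_le {ι : Type*} (s : Finset ι) (b : ι → ℝ≥0∞) {r : ℝ} (hr : 0 < r) :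
    (∑ i ∈ s, b i) ^ r ≤ (s.card : ℝ≥0∞) ^ r * ∑ i ∈ s, b i ^ r := by
  have h1 : ∀ i ∈ s, b i ≤ (∑ i ∈ s, b i ^ r) ^ (1 / r) := fun i hi => by
    calc b i = (b i ^ r) ^ (1 / r) := by
          rw [← ENNReal.rpow_mul, mul_one_div_cancel hr.ne', ENNReal.rpow_one]
      _ ≤ _ := by
          gcongr
          exact Finset.single_le_sum (f := fun i => b i ^ r) (fun _ _ => zero_le) hi
  calc _ ≤ (s.card * (∑ i ∈ s, b i ^ r) ^ (1 / r)) ^ r := by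
        refine ENNReal.rpow_le_rpow ((Finset.sum_le_card_nsmul _ _ _ h1).trans_eq ?_) hr.le
        rw [nsmul_eq_mul]
    _ = _ := by
        rw [ENNReal.mul_rpow_of_nonneg _ _ hr.le, ← ENNReal.rpow_mul, one_div_mul_cancel hr.ne',
          ENNReal.rpow_one]

/-- The constant in the `L^p` bound for nonnegative functions. -/
def lpNonnegConst (n : ℕ) (α p : ℝ) : ℝ≥0∞ :=
  (gridConst n α ^ 2) ^ (p / 2) * (((Finset.univ : Finset (Fin n → Bool)).card : ℝ≥0∞) ^ (p / 2) *
    ∑ _ω : Fin n → Bool, CellFiltration.geomConst p (2 ^ n) (decay α))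

lemma lpNonnegConst_ne_top (hα : 0 < α) {p : ℝ} (hp : 1 < p) : lpNonnegConst n α p ≠ ∞ := by
  have hp0 : 0 ≤ p / 2 := by linarith
  refine ENNReal.mul_ne_top (ENNReal.rpow_ne_top_of_nonneg hp0
    (ENNReal.pow_ne_top ENNReal.ofReal_ne_top)) (ENNReal.mul_ne_top
      (ENNReal.rpow_ne_top_of_nonneg hp0 (ENNReal.natCast_ne_top _)) ?_)
  exact ENNReal.sum_ne_top.2 fun _ _ => CellFiltration.geomConst_ne_top hp
    (one_le_pow₀ one_le_two) (decay_lt_one hα)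

/-- `L^p` bound for the intrinsic square function of a nonnegative function. -/
lemma lintegral_supConv_rpow_le (hα : 0 < α) (hα1 : α ≤ 1) (hn : 0 < n) {p : ℝ} (hp : 1 < p)
    {f : EuclideanSpace ℝ (Fin n) → ℝ} (hfm : Measurable f) (hf : Integrable f)
    (h0 : ∀ x, 0 ≤ f x) (hfin : ∫⁻ x, ENNReal.ofReal (f x) ^ p < ∞) :
    ∫⁻ x, (∫⁻ t in Ioi (0 : ℝ), supConv α f x t ^ (2 : ℕ) / ENNReal.ofReal t) ^ (p / 2) ≤
      lpNonnegConst n α p * ∫⁻ x, ENNReal.ofReal (f x) ^ p := by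
  have hp0 : 0 < p / 2 := by linarith
  have hloc := hf.locallyIntegrable
  -- Grids with top cubes of side 7 (N + 1) handle t < N + 1 with constants independent of N;
  -- monotone convergence then reaches all t.
  have hmono : Monotone fun N : ℕ => Ioo (0 : ℝ) (7 * ((N : ℝ) + 1) / 7) := fun M N h => by
    refine Ioo_subset_Ioo le_rfl ?_
    have : (M : ℝ) ≤ N := by exact_mod_cast h
    linarith
  have hunion : ⋃ N : ℕ, Ioo (0 : ℝ) (7 * ((N : ℝ) + 1) / 7) = Ioi 0 := by
    ext t
    simp only [mem_iUnion, mem_Ioo, mem_Ioi]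
    refine ⟨fun ⟨_, h, _⟩ => h, fun h => ?_⟩
    obtain ⟨N, hN⟩ := exists_nat_gt t
    exact ⟨N, h, by linarith⟩
  have hptlim : ∀ x, Tendsto (fun N : ℕ => ∫⁻ t in Ioo (0 : ℝ) (7 * ((N : ℝ) + 1) / 7),
      supConv α f x t ^ (2 : ℕ) / ENNReal.ofReal t) atTop
      (𝓝 (∫⁻ t in Ioi (0 : ℝ), supConv α f x t ^ (2 : ℕ) / ENNReal.ofReal t)) := fun x => by
    rw [← hunion, setLIntegral_iUnion_of_directed _ hmono.directed_le]
    exact tendsto_atTop_iSup fun M N h => lintegral_mono_set (hmono h)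
  have hlim := lintegral_tendsto_of_tendsto_of_monotone
    (μ := (volume : Measure (EuclideanSpace ℝ (Fin n))))
    (f := fun (N : ℕ) x => (∫⁻ t in Ioo (0 : ℝ) (7 * ((N : ℝ) + 1) / 7),
      supConv α f x t ^ (2 : ℕ) / ENNReal.ofReal t) ^ (p / 2))
    (F := fun x => (∫⁻ t in Ioi (0 : ℝ), supConv α f x t ^ (2 : ℕ) / ENNReal.ofReal t) ^ (p / 2))
    (fun N => ((measurable_lintegral_supConv hα hα1 hn hloc measurableSet_Ioo
      Ioo_subset_Ioi_self).pow_const _).aemeasurable)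
    (ae_of_all _ fun x M N h => ENNReal.rpow_le_rpow (lintegral_mono_set (hmono h)) hp0.le)
    (ae_of_all _ fun x => (ENNReal.continuous_rpow_const.tendsto _).comp (hptlim x))
  refine le_of_tendsto' hlim fun N => ?_
  have hL : (0 : ℝ) < 7 * ((N : ℝ) + 1) := by positivity
  have hGm : ∀ ω : Fin n → Bool, Measurable
      ((dyadicGrid hL (thirdShift (7 * ((N : ℝ) + 1)) ω)).geomSq (decay α) f) := fun ω => by
    unfold CellFiltration.geomSq
    have := fun k m => (dyadicGrid hL (thirdShift (7 * ((N : ℝ) + 1)) ω)).measurable_lmean k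
      (fun y => ‖(dyadicGrid hL (thirdShift (7 * ((N : ℝ) + 1)) ω)).diff (k + m) f y‖ₑ)
    exact Measurable.tsum fun k =>
      (Measurable.tsum fun m => (this k m).const_mul _).pow_const 2
  calc _ ≤ ∫⁻ x, (gridConst n α ^ 2) ^ (p / 2) *
        (((Finset.univ : Finset (Fin n → Bool)).card : ℝ≥0∞) ^ (p / 2) * ∑ ω : Fin n → Bool,
          (dyadicGrid hL (thirdShift (7 * ((N : ℝ) + 1)) ω)).geomSq (decay α) f x ^ (p / 2)) := by
        refine lintegral_mono fun x => ?_
        refine (ENNReal.rpow_le_rpow (lintegral_Ioo_supConv_le hL hα hα1 hn hfm hf h0 x)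
          hp0.le).trans ?_
        rw [ENNReal.mul_rpow_of_nonneg _ _ hp0.le]
        gcongr
        exact finset_sum_rpow_le _ _ hp0
    _ = (gridConst n α ^ 2) ^ (p / 2) *
        (((Finset.univ : Finset (Fin n → Bool)).card : ℝ≥0∞) ^ (p / 2) * ∑ ω : Fin n → Bool,
          ∫⁻ x, (dyadicGrid hL (thirdShift (7 * ((N : ℝ) + 1)) ω)).geomSq (decay α) f x ^
            (p / 2)) := by
        rw [lintegral_const_mul _ (by fun_prop), lintegral_const_mul _ (by fun_prop),
          lintegral_finsetSum _ fun ω _ => by fun_prop]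
    _ ≤ (gridConst n α ^ 2) ^ (p / 2) *
        (((Finset.univ : Finset (Fin n → Bool)).card : ℝ≥0∞) ^ (p / 2) * ∑ ω : Fin n → Bool,
          CellFiltration.geomConst p (2 ^ n) (decay α) * ∫⁻ x, ENNReal.ofReal (f x) ^ p) := by
        gcongr with ω
        exact CellFiltration.lintegral_geomSq_le _ hp (one_le_pow₀ one_le_two) _ hfm hf h0 hfin
    _ = _ := by
        rw [lpNonnegConst, ← Finset.sum_mul]
        ring

end IntrinsicMorrey

/-! ### The L^p bound for real- or complex-valued functions -/

namespace IntrinsicMorrey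

variable {n : ℕ} {α : ℝ} {𝕜 : Type*} [RCLike 𝕜]

/-- The square of the intrinsic Littlewood–Paley function. -/
def gSq (α : ℝ) (f : EuclideanSpace ℝ (Fin n) → 𝕜) (x : EuclideanSpace ℝ (Fin n)) : ℝ≥0∞ :=
  ∫⁻ t in Ioi (0 : ℝ), supConv α f x t ^ (2 : ℕ) / ENNReal.ofReal t

lemma gFun_rpow (α p : ℝ) (f : EuclideanSpace ℝ (Fin n) → 𝕜) (x : EuclideanSpace ℝ (Fin n)) :
    gFun α f x ^ p = gSq α f x ^ (p / 2) := by
  rw [gFun, gSq, ← ENNReal.rpow_mul]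
  congr 1
  ring

lemma measurable_gSq (hα : 0 < α) (hα1 : α ≤ 1) (hn : 0 < n)
    {f : EuclideanSpace ℝ (Fin n) → 𝕜} (hf : LocallyIntegrable f) : Measurable (gSq α f) :=
  measurable_lintegral_supConv hα hα1 hn hf measurableSet_Ioi le_rfl

lemma aemeasurable_supConv_right (hα : 0 < α) (hα1 : α ≤ 1) (hn : 0 < n)
    {f : EuclideanSpace ℝ (Fin n) → 𝕜} (hf : LocallyIntegrable f) (x : EuclideanSpace ℝ (Fin n)) :
    AEMeasurable (supConv α f x) (volume.restrict (Ioi 0)) := by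
  have hm := (measurable_supConv hα hα1 hn hf).comp (measurable_prodMk_left (x := x))
  refine hm.aemeasurable.congr ?_
  filter_upwards [ae_restrict_mem measurableSet_Ioi] with t ht
  simp only [Function.comp]
  rw [indicator_of_mem (show (x, t) ∈ {q : EuclideanSpace ℝ (Fin n) × ℝ | 0 < q.2} from ht)]

lemma supConv_congr_ae {f g : EuclideanSpace ℝ (Fin n) → 𝕜} (h : f =ᵐ[volume] g) :
    supConv α f = supConv α g := by
  funext x t
  simp only [supConv]
  refine iSup_congr fun φ => iSup_congr fun _ => ?_
  congr 1
  exact integral_congr_ae (h.mono fun z hz => by simp only [hz])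

/-- Transfers sublinearity from the convolutions to powers of the square function. It serves both
the decomposition into four nonnegative parts and the near/far splitting. -/
lemma gSq_rpow_le_sum (hα : 0 < α) (hα1 : α ≤ 1) (hn : 0 < n) {ι 𝕜' : Type*} [RCLike 𝕜']
    (s : Finset ι) {f : EuclideanSpace ℝ (Fin n) → 𝕜'} {h : ι → EuclideanSpace ℝ (Fin n) → 𝕜}
    (hloc : ∀ i, LocallyIntegrable (h i)) {x : EuclideanSpace ℝ (Fin n)}
    (hle : ∀ t, 0 < t → supConv α f x t ≤ ∑ i ∈ s, supConv α (h i) x t) {r : ℝ} (hr : 0 < r) :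
    gSq α f x ^ r ≤ ((s.card : ℝ≥0∞) ^ 2) ^ r * ((s.card : ℝ≥0∞) ^ r *
      ∑ i ∈ s, gSq α (h i) x ^ r) := by
  have hm := fun i => aemeasurable_supConv_right hα hα1 hn (hloc i) x
  have h1 : gSq α f x ≤ (s.card : ℝ≥0∞) ^ 2 * ∑ i ∈ s, gSq α (h i) x := by
    calc gSq α f x ≤ ∫⁻ t in Ioi (0 : ℝ), (s.card : ℝ≥0∞) ^ 2 *
          ∑ i ∈ s, supConv α (h i) x t ^ (2 : ℕ) / ENNReal.ofReal t := by
          refine setLIntegral_mono' measurableSet_Ioi fun t ht => ?_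
          have h2 := finset_sum_rpow_le s (fun i => supConv α (h i) x t) two_pos
          simp only [ENNReal.rpow_two] at h2
          simp only [div_eq_mul_inv]
          rw [← Finset.sum_mul, ← mul_assoc]
          gcongr
          exact (pow_le_pow_left₀ zero_le (hle t ht) 2).trans h2
      _ = _ := by
          rw [lintegral_const_mul'' _ (by fun_prop), lintegral_finsetSum' _ fun i _ => by fun_prop]
          rfl
  refine (ENNReal.rpow_le_rpow h1 hr.le).trans ?_
  rw [ENNReal.mul_rpow_of_nonneg _ _ hr.le]
  gcongr
  exact finset_sum_rpow_le _ _ hr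

lemma hasCompactSupport_dilate {φ : EuclideanSpace ℝ (Fin n) → ℝ} (hφ : IsAdmissible α φ) {t : ℝ}
    (ht : 0 < t) (x : EuclideanSpace ℝ (Fin n)) :
    HasCompactSupport fun z => dilate φ t (x - z) :=
  HasCompactSupport.intro (isCompact_closedBall x t) fun _ hz => dilate_eq_zero ht hφ hz

lemma integrable_dilate_smul {φ : EuclideanSpace ℝ (Fin n) → ℝ} (hφ : IsAdmissible α φ)
    (hα : 0 < α) {t : ℝ} (ht : 0 < t) (x : EuclideanSpace ℝ (Fin n))
    {f : EuclideanSpace ℝ (Fin n) → 𝕜} (hf : LocallyIntegrable f) :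
    Integrable fun z => dilate φ t (x - z) • f z :=
  hf.integrable_smul_left_of_hasCompactSupport
    ((continuous_dilate hφ hα t).comp (continuous_const.sub continuous_id))
    (hasCompactSupport_dilate hφ ht x)

lemma supConv_add_le (hα : 0 < α) {t : ℝ} (ht : 0 < t) (x : EuclideanSpace ℝ (Fin n))
    {f g : EuclideanSpace ℝ (Fin n) → 𝕜} (hf : LocallyIntegrable f) (hg : LocallyIntegrable g) :
    supConv α (f + g) x t ≤ supConv α f x t + supConv α g x t := by
  refine iSup₂_le fun φ hφ => ?_
  simp only [Pi.add_apply, smul_add]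
  rw [integral_add (integrable_dilate_smul hφ hα ht x hf) (integrable_dilate_smul hφ hα ht x hg)]
  refine (enorm_add_le _ _).trans (add_le_add ?_ ?_)
  · exact le_iSup₂ (f := fun φ (_ : IsAdmissible α φ) => ‖∫ z, dilate φ t (x - z) • f z‖ₑ) φ hφ
  · exact le_iSup₂ (f := fun φ (_ : IsAdmissible α φ) => ‖∫ z, dilate φ t (x - z) • g z‖ₑ) φ hφ

/-- Positive and negative parts of the real and imaginary parts. -/
def parts (f : EuclideanSpace ℝ (Fin n) → 𝕜) : Fin 4 → EuclideanSpace ℝ (Fin n) → ℝ :=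
  ![fun x => max (RCLike.re (f x)) 0, fun x => max (-RCLike.re (f x)) 0,
    fun x => max (RCLike.im (f x)) 0, fun x => max (-RCLike.im (f x)) 0]

lemma parts_nonneg (f : EuclideanSpace ℝ (Fin n) → 𝕜) (i : Fin 4) (x : EuclideanSpace ℝ (Fin n)) :
    0 ≤ parts f i x := by
  fin_cases i <;> exact le_max_right _ _

lemma parts_le_norm (f : EuclideanSpace ℝ (Fin n) → 𝕜) (i : Fin 4)
    (x : EuclideanSpace ℝ (Fin n)) : parts f i x ≤ ‖f x‖ := by
  have h1 := abs_le.1 (RCLike.abs_re_le_norm (f x))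
  have h2 := abs_le.1 (RCLike.abs_im_le_norm (f x))
  fin_cases i <;> exact max_le (by linarith) (norm_nonneg _)

lemma measurable_parts {f : EuclideanSpace ℝ (Fin n) → 𝕜} (hf : Measurable f) (i : Fin 4) :
    Measurable (parts f i) := by
  have h1 : Measurable fun x => RCLike.re (f x) := RCLike.measurable_re.comp hf
  have h2 : Measurable fun x => RCLike.im (f x) := RCLike.measurable_im.comp hf
  fin_cases i
  exacts [h1.max measurable_const, h1.neg.max measurable_const, h2.max measurable_const,
    h2.neg.max measurable_const]

lemma supConv_le_sum_parts (hα : 0 < α) {t : ℝ} (ht : 0 < t) (x : EuclideanSpace ℝ (Fin n))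
    {f : EuclideanSpace ℝ (Fin n) → 𝕜} (hf : LocallyIntegrable f)
    (hp : ∀ i, LocallyIntegrable (parts f i)) :
    supConv α f x t ≤ ∑ i, supConv α (parts f i) x t := by
  refine iSup₂_le fun φ hφ => ?_
  have hint := integrable_dilate_smul hφ hα ht x hf
  have hpint := fun i => integrable_dilate_smul hφ hα ht x (hp i)
  have hle : ∀ i, ‖∫ z, dilate φ t (x - z) • parts f i z‖ₑ ≤ supConv α (parts f i) x t := fun i =>
    le_iSup₂ (f := fun φ (_ : IsAdmissible α φ) => ‖∫ z, dilate φ t (x - z) • parts f i z‖ₑ) φ hφ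
  have hmax : ∀ a : ℝ, a = max a 0 - max (-a) 0 := fun a => by
    rcases le_total a 0 with h | h
    · rw [max_eq_right h, max_eq_left (by linarith)]; ring
    · rw [max_eq_left h, max_eq_right (by linarith)]; ring
  have hre : RCLike.re (∫ z, dilate φ t (x - z) • f z) =
      (∫ z, dilate φ t (x - z) • parts f 0 z) - ∫ z, dilate φ t (x - z) • parts f 1 z := by
    rw [← integral_re hint, ← integral_sub (hpint 0) (hpint 1)]
    refine integral_congr_ae (ae_of_all _ fun z => ?_)
    simp only [RCLike.smul_re, smul_eq_mul, ← mul_sub]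
    rw [hmax (RCLike.re (f z))]
    rfl
  have him : RCLike.im (∫ z, dilate φ t (x - z) • f z) =
      (∫ z, dilate φ t (x - z) • parts f 2 z) - ∫ z, dilate φ t (x - z) • parts f 3 z := by
    rw [← integral_im hint, ← integral_sub (hpint 2) (hpint 3)]
    refine integral_congr_ae (ae_of_all _ fun z => ?_)
    simp only [RCLike.smul_im, smul_eq_mul, ← mul_sub]
    rw [hmax (RCLike.im (f z))]
    rfl
  have hnorm : ‖∫ z, dilate φ t (x - z) • f z‖ₑ ≤
      ‖(RCLike.re (∫ z, dilate φ t (x - z) • f z) : ℝ)‖ₑ +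
        ‖(RCLike.im (∫ z, dilate φ t (x - z) • f z) : ℝ)‖ₑ := by
    rw [Real.enorm_eq_ofReal_abs, Real.enorm_eq_ofReal_abs,
      ← ENNReal.ofReal_add (abs_nonneg _) (abs_nonneg _), ← ofReal_norm]
    refine ENNReal.ofReal_le_ofReal ((pow_le_pow_iff_left₀ (norm_nonneg _)
      (add_nonneg (abs_nonneg _) (abs_nonneg _)) two_ne_zero).1 ?_)
    rw [RCLike.norm_sq_eq_def, add_sq, sq_abs, sq_abs]
    nlinarith [mul_nonneg (abs_nonneg (RCLike.re (∫ z, dilate φ t (x - z) • f z)))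
      (abs_nonneg (RCLike.im (∫ z, dilate φ t (x - z) • f z)))]
  rw [hre, him] at hnorm
  rw [Fin.sum_univ_four, add_assoc (_ + _)]
  exact hnorm.trans (add_le_add (enorm_sub_le.trans (add_le_add (hle 0) (hle 1)))
    (enorm_sub_le.trans (add_le_add (hle 2) (hle 3))))

/-- The constant in the `L^p` bound. -/
def lpConst (n : ℕ) (α p : ℝ) : ℝ≥0∞ :=
  ((4 : ℝ≥0∞) ^ 2) ^ (p / 2) * (4 ^ (p / 2) * (4 * lpNonnegConst n α p))

lemma lpConst_ne_top (hα : 0 < α) {p : ℝ} (hp : 1 < p) : lpConst n α p ≠ ∞ := by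
  have hp0 : 0 ≤ p / 2 := by linarith
  exact ENNReal.mul_ne_top (ENNReal.rpow_ne_top_of_nonneg hp0 (by norm_num))
    (ENNReal.mul_ne_top (ENNReal.rpow_ne_top_of_nonneg hp0 (by norm_num))
      (ENNReal.mul_ne_top (by norm_num) (lpNonnegConst_ne_top hα hp)))

/-- The intrinsic square function is bounded on `L^p`. -/
lemma lintegral_gSq_rpow_le (hα : 0 < α) (hα1 : α ≤ 1) (hn : 0 < n) {p : ℝ} (hp : 1 < p)
    {f : EuclideanSpace ℝ (Fin n) → 𝕜} (hf : Integrable f) (hfin : ∫⁻ x, ‖f x‖ₑ ^ p < ∞) :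
    ∫⁻ x, gSq α f x ^ (p / 2) ≤ lpConst n α p * ∫⁻ x, ‖f x‖ₑ ^ p := by
  have hp0 : 0 < p / 2 := by linarith
  -- The convolutions see only the almost-everywhere class of f, so a Borel representative may be
  -- used.
  set g := hf.1.mk f with hg
  have hfg : f =ᵐ[volume] g := hf.1.ae_eq_mk
  have hgm : Measurable g := hf.1.stronglyMeasurable_mk.measurable
  have hgi : Integrable g := hf.congr hfg
  have hSeq : gSq α f = gSq α g := by
    funext x
    simp only [gSq, supConv_congr_ae hfg]
  have hpow : ∫⁻ x, ‖f x‖ₑ ^ p = ∫⁻ x, ‖g x‖ₑ ^ p :=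
    lintegral_congr_ae (hfg.mono fun x hx => by simp only [hx])
  rw [hSeq, hpow]
  rw [hpow] at hfin
  have hpi : ∀ i, Integrable (parts g i) := fun i =>
    hgi.norm.mono' (measurable_parts hgm i).aestronglyMeasurable (ae_of_all _ fun x => by
      rw [Real.norm_of_nonneg (parts_nonneg g i x)]
      exact parts_le_norm g i x)
  have hple : ∀ i, ∫⁻ x, ENNReal.ofReal (parts g i x) ^ p ≤ ∫⁻ x, ‖g x‖ₑ ^ p := fun i => by
    refine lintegral_mono fun x => ENNReal.rpow_le_rpow ?_ (by linarith)
    rw [← ofReal_norm]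
    exact ENNReal.ofReal_le_ofReal (parts_le_norm g i x)
  have hm := fun i => measurable_gSq hα hα1 hn (hpi i).locallyIntegrable
  calc ∫⁻ x, gSq α g x ^ (p / 2) ≤ ∫⁻ x, ((4 : ℝ≥0∞) ^ 2) ^ (p / 2) *
        (4 ^ (p / 2) * ∑ i, gSq α (parts g i) x ^ (p / 2)) := by
        refine lintegral_mono fun x => ?_
        have := gSq_rpow_le_sum hα hα1 hn Finset.univ (f := g) (x := x)
          (fun i => (hpi i).locallyIntegrable)
          (fun t ht => supConv_le_sum_parts hα ht x hgi.locallyIntegrable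
            fun i => (hpi i).locallyIntegrable) hp0
        simpa using this
    _ = ((4 : ℝ≥0∞) ^ 2) ^ (p / 2) *
        (4 ^ (p / 2) * ∑ i, ∫⁻ x, gSq α (parts g i) x ^ (p / 2)) := by
        rw [lintegral_const_mul _ (by fun_prop), lintegral_const_mul _ (by fun_prop),
          lintegral_finsetSum _ fun i _ => by fun_prop]
    _ ≤ ((4 : ℝ≥0∞) ^ 2) ^ (p / 2) *
        (4 ^ (p / 2) * ∑ _i : Fin 4, lpNonnegConst n α p * ∫⁻ x, ‖g x‖ₑ ^ p) := by
        gcongr with i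
        refine (lintegral_supConv_rpow_le hα hα1 hn hp (measurable_parts hgm i) (hpi i)
          (parts_nonneg g i) ((hple i).trans_lt hfin)).trans ?_
        exact mul_le_mul' le_rfl (hple i)
    _ = _ := by
        rw [lpConst, Finset.sum_const, Finset.card_univ, Fintype.card_fin, nsmul_eq_mul]
        push_cast
        ring

end IntrinsicMorrey

/-! ### The far part -/

namespace IntrinsicMorrey

lemma setLIntegral_le_rpow_mul {X : Type*} [MeasurableSpace X] {μ : Measure X} {u : X → ℝ≥0∞}
    {s : Set X} (hu : AEMeasurable u (μ.restrict s)) {p : ℝ} (hp : 1 < p) :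
    ∫⁻ x in s, u x ∂μ ≤ (∫⁻ x in s, u x ^ p ∂μ) ^ (1 / p) * μ s ^ (1 - 1 / p) := by
  have hp0 : 0 < p := by linarith
  have := ENNReal.lintegral_mul_norm_pow_le (hu.pow_const p)
    (aemeasurable_const (b := (1 : ℝ≥0∞))) (one_div_pos.2 hp0).le
    (sub_nonneg.2 ((div_le_one hp0).2 hp.le)) (add_sub_cancel (1 / p) 1)
  simpa only [← ENNReal.rpow_mul, mul_one_div_cancel hp0.ne', ENNReal.rpow_one, ENNReal.one_rpow,
    mul_one, lintegral_one, Measure.restrict_apply_univ] using this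

variable {n : ℕ} {α p D : ℝ} {Φ : ℝ → ℝ} {𝕜 : Type*} [RCLike 𝕜]

lemma IsGrowthFunction.le_pow (hΦ : IsGrowthFunction Φ D) {r : ℝ} (hr : 0 < r) (j : ℕ) :
    Φ (2 ^ j * r) ≤ D ^ j * Φ r := by
  induction j with
  | zero => simp
  | succ j ih =>
    have hD := hΦ.one_le
    calc Φ (2 ^ (j + 1) * r) = Φ (2 * (2 ^ j * r)) := by rw [pow_succ]; ring_nf
      _ ≤ D * Φ (2 ^ j * r) := hΦ.doubling _ (by positivity)
      _ ≤ D * (D ^ j * Φ r) := by gcongr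
      _ = _ := by ring

/-- `C` bounds the Morrey norm of `f`. -/
def IsMorreyBound {ε : Type*} [ENorm ε] (p : ℝ) (Φ : ℝ → ℝ) (f : EuclideanSpace ℝ (Fin n) → ε)
    (C : ℝ≥0∞) : Prop :=
  ∀ (x₀ : EuclideanSpace ℝ (Fin n)) (r : ℝ), 0 < r →
    ∫⁻ x in Metric.ball x₀ r, ‖f x‖ₑ ^ p ≤ C ^ p * ENNReal.ofReal (Φ r)

lemma IsMorreyBound.pow {f : EuclideanSpace ℝ (Fin n) → 𝕜} {C : ℝ≥0∞}
    (h : IsMorreyBound p Φ f C) (hΦ : IsGrowthFunction Φ D) (x₀ : EuclideanSpace ℝ (Fin n)) {r : ℝ}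
    (hr : 0 < r) (j : ℕ) : ∫⁻ x in Metric.ball x₀ (2 ^ j * r), ‖f x‖ₑ ^ p ≤
      ENNReal.ofReal D ^ j * (C ^ p * ENNReal.ofReal (Φ r)) := by
  have hD : 0 ≤ D := zero_le_one.trans hΦ.one_le
  calc _ ≤ C ^ p * ENNReal.ofReal (Φ (2 ^ j * r)) := h x₀ _ (by positivity)
    _ ≤ C ^ p * ENNReal.ofReal (D ^ j * Φ r) := by gcongr; exact hΦ.le_pow hr j
    _ = _ := by
      rw [ENNReal.ofReal_mul (by positivity), ENNReal.ofReal_pow hD]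
      ring

lemma volume_ball_eq (hn : 0 < n) (x : EuclideanSpace ℝ (Fin n)) {r : ℝ} (hr : 0 ≤ r) :
    volume (Metric.ball x r) =
      ENNReal.ofReal r ^ n * volume (Metric.ball (0 : EuclideanSpace ℝ (Fin n)) 1) := by
  have : Nonempty (Fin n) := ⟨⟨0, hn⟩⟩
  rw [Measure.addHaar_ball _ _ hr, finrank_euclideanSpace_fin, ENNReal.ofReal_pow hr]

/-- The constant in the estimate of the far part. -/
def farConst (n : ℕ) (p D : ℝ) : ℝ≥0∞ :=
  3 * ((ENNReal.ofReal D ^ 2) ^ (1 / p) *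
    (4 ^ n * volume (Metric.ball (0 : EuclideanSpace ℝ (Fin n)) 1)) ^ (1 - 1 / p))

lemma farConst_ne_top (hp : 1 < p) : farConst n p D ≠ ∞ := by
  have hp0 : 0 < p := by linarith
  have h1 : 0 ≤ 1 - 1 / p := sub_nonneg.2 ((div_le_one hp0).2 hp.le)
  refine ENNReal.mul_ne_top (by norm_num) (ENNReal.mul_ne_top
    (ENNReal.rpow_ne_top_of_nonneg (by positivity) (ENNReal.pow_ne_top ENNReal.ofReal_ne_top))
    (ENNReal.rpow_ne_top_of_nonneg h1 (ENNReal.mul_ne_top (ENNReal.pow_ne_top (by norm_num))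
      measure_ball_lt_top.ne)))

lemma supConv_le_lintegral (hα : 0 < α) (hα1 : α ≤ 1) (hn : 0 < n) {t : ℝ} (ht : 0 < t)
    (f : EuclideanSpace ℝ (Fin n) → 𝕜) (x : EuclideanSpace ℝ (Fin n)) :
    supConv α f x t ≤ 3 * (ENNReal.ofReal t ^ n)⁻¹ * ∫⁻ z in Metric.closedBall x t, ‖f z‖ₑ := by
  refine iSup₂_le fun φ hφ => ?_
  calc _ ≤ ∫⁻ z, ‖dilate φ t (x - z) • f z‖ₑ := enorm_integral_le_lintegral_enorm _
    _ ≤ ∫⁻ z, (Metric.closedBall x t).indicator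
        (fun z => 3 * (ENNReal.ofReal t ^ n)⁻¹ * ‖f z‖ₑ) z := by
        refine lintegral_mono fun z => ?_
        by_cases hz : z ∈ Metric.closedBall x t
        · rw [indicator_of_mem hz, enorm_smul]
          gcongr
          have h3 : (3 : ℝ≥0∞) = ENNReal.ofReal 3 := (ENNReal.ofReal_ofNat 3).symm
          rw [Real.enorm_eq_ofReal_abs, ← ENNReal.ofReal_pow ht.le,
            ← ENNReal.ofReal_inv_of_pos (by positivity), h3,
            ← ENNReal.ofReal_mul (by norm_num), mul_comm]
          exact ENNReal.ofReal_le_ofReal (abs_dilate_le ht hφ hα hα1 hn _)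
        · rw [dilate_eq_zero ht hφ hz, zero_smul, enorm_zero]
          exact zero_le
    _ = _ := by
        rw [lintegral_indicator Metric.isClosed_closedBall.measurableSet,
          lintegral_const_mul' _ _ (ENNReal.mul_ne_top (by norm_num)
            (ENNReal.inv_ne_top.2 (pow_ne_zero n (by simpa using ht))))]

/-- Size of the convolutions at scale `2 ^ j * r`, for centers in a ball of radius `r`. -/
lemma supConv_far_le (hα : 0 < α) (hα1 : α ≤ 1) (hn : 0 < n) (hp : 1 < p)
    (hΦ : IsGrowthFunction Φ D) {f g : EuclideanSpace ℝ (Fin n) → 𝕜} (hf : LocallyIntegrable f)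
    (hgf : ∀ z, ‖g z‖ₑ ≤ ‖f z‖ₑ) {C : ℝ≥0∞} (h : IsMorreyBound p Φ f C)
    {x₀ x : EuclideanSpace ℝ (Fin n)} {r : ℝ} (hr : 0 < r) (hx : x ∈ Metric.ball x₀ r) (j : ℕ)
    {t : ℝ} (ht : 2 ^ j * r ≤ t) (ht' : t ≤ 2 * (2 ^ j * r)) :
    supConv α g x t ≤ farConst n p D * (ENNReal.ofReal (D / 2 ^ n) ^ j *
      (C ^ p * ENNReal.ofReal (Φ r) / ENNReal.ofReal r ^ n)) ^ (1 / p) := by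
  have hp0 : 0 < p := by linarith
  have hp1 : 0 ≤ 1 - 1 / p := sub_nonneg.2 ((div_le_one hp0).2 hp.le)
  set M := C ^ p * ENNReal.ofReal (Φ r) with hM
  set v := volume (Metric.ball (0 : EuclideanSpace ℝ (Fin n)) 1) with hv
  set R := ENNReal.ofReal (2 ^ j * r) ^ n with hR
  have hj : (0 : ℝ) < 2 ^ j := by positivity
  have hj1 : (1 : ℝ) ≤ 2 ^ j := one_le_pow₀ one_le_two
  have ht0 : 0 < t := lt_of_lt_of_le (by positivity) ht
  have hR0 : R ≠ 0 := pow_ne_zero n (by simpa using by positivity)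
  have hRt : R ≠ ∞ := ENNReal.pow_ne_top ENNReal.ofReal_ne_top
  -- The distance to the centre is less than 2^(j+1) r + r, hence less than 2^(j+2) r.
  have hsub : Metric.closedBall x t ⊆ Metric.ball x₀ (2 ^ (j + 2) * r) := by
    intro z hz
    rw [Metric.mem_closedBall] at hz
    rw [Metric.mem_ball] at hx ⊢
    have := dist_triangle z x x₀
    rw [pow_add]
    nlinarith
  have hint : ∫⁻ z in Metric.closedBall x t, ‖g z‖ₑ ≤
      (ENNReal.ofReal D ^ (j + 2) * M) ^ (1 / p) * (4 ^ n * v * R) ^ (1 - 1 / p) := by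
    calc _ ≤ ∫⁻ z in Metric.closedBall x t, ‖f z‖ₑ := lintegral_mono hgf
      _ ≤ ∫⁻ z in Metric.ball x₀ (2 ^ (j + 2) * r), ‖f z‖ₑ := lintegral_mono_set hsub
      _ ≤ _ := setLIntegral_le_rpow_mul hf.aestronglyMeasurable.restrict.enorm hp
      _ ≤ _ := by
        gcongr
        · exact h.pow hΦ x₀ hr (j + 2)
        · rw [volume_ball_eq hn _ (by positivity), hR, pow_add, mul_comm ((2 : ℝ) ^ j), mul_assoc,
            ENNReal.ofReal_mul (by norm_num), mul_pow]
          norm_num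
          rw [mul_right_comm]
  calc supConv α g x t ≤ 3 * (ENNReal.ofReal t ^ n)⁻¹ * ∫⁻ z in Metric.closedBall x t, ‖g z‖ₑ :=
        supConv_le_lintegral hα hα1 hn ht0 g x
    _ ≤ 3 * R⁻¹ * ((ENNReal.ofReal D ^ (j + 2) * M) ^ (1 / p) *
        (4 ^ n * v * R) ^ (1 - 1 / p)) := by
        gcongr
        rw [hR]
        gcongr
    _ = 3 * ((ENNReal.ofReal D ^ 2) ^ (1 / p) * (4 ^ n * v) ^ (1 - 1 / p)) *
        ((ENNReal.ofReal D ^ j * M) ^ (1 / p) * (R⁻¹ * R ^ (1 - 1 / p))) := by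
        have e : ENNReal.ofReal D ^ (j + 2) * M = ENNReal.ofReal D ^ j * M * ENNReal.ofReal D ^ 2 := by
          ring
        rw [ENNReal.mul_rpow_of_nonneg _ R hp1, e,
          ENNReal.mul_rpow_of_nonneg _ (ENNReal.ofReal D ^ 2) (by positivity)]
        ring
    _ = _ := by
        have h1 : R⁻¹ * R ^ (1 - 1 / p) = (R⁻¹) ^ (1 / p) := by
          rw [← ENNReal.rpow_neg_one, ← ENNReal.rpow_add _ _ hR0 hRt, ← ENNReal.rpow_mul]
          congr 1
          ring
        rw [h1, ← ENNReal.mul_rpow_of_nonneg _ _ (by positivity), farConst]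
        congr 2
        -- The growth D^j of Φ competes with the volume growth 2^(nj) inside the power 1/p; this is
        -- the source of the ratio D / 2^n.
        have h2 : R = (2 ^ n) ^ j * ENNReal.ofReal r ^ n := by
          rw [hR, ENNReal.ofReal_mul (by positivity), mul_pow, ENNReal.ofReal_pow zero_le_two,
            ENNReal.ofReal_ofNat, ← pow_mul, ← pow_mul, mul_comm j]
        rw [h2, ENNReal.mul_inv (Or.inl (by positivity)) (Or.inl (ENNReal.pow_ne_top
          (ENNReal.pow_ne_top (by norm_num)))), ENNReal.ofReal_div_of_pos (by positivity),
          ENNReal.ofReal_pow zero_le_two, ENNReal.ofReal_ofNat, div_eq_mul_inv, div_eq_mul_inv,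
          mul_pow, ENNReal.inv_pow]
        ring

/-- The constant in the pointwise estimate of the far part of the square function. -/
def farSqConst (n : ℕ) (p D : ℝ) : ℝ≥0∞ :=
  (farConst n p D ^ 2 * (1 - ENNReal.ofReal (D / 2 ^ n) ^ (2 / p))⁻¹) ^ (p / 2)

/-- Here D < 2^n is decisive: it makes the ratio of the geometric series over the scales less than
1. -/
lemma farSqConst_ne_top (hp : 1 < p) (hD : D < 2 ^ n) : farSqConst n p D ≠ ∞ := by
  have h1 : ENNReal.ofReal (D / 2 ^ n) < 1 := by
    rw [ENNReal.ofReal_lt_one, div_lt_one (by positivity)]; exact hD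
  have h2 := ENNReal.rpow_lt_one h1 (show 0 < 2 / p by positivity)
  refine ENNReal.rpow_ne_top_of_nonneg (by linarith) (ENNReal.mul_ne_top
    (ENNReal.pow_ne_top (farConst_ne_top hp)) ?_)
  simpa [tsub_eq_zero_iff_le] using h2

lemma lintegral_Ico_div_le {a : ℝ} (ha : 0 < a) (c : ℝ≥0∞) :
    ∫⁻ t in Ico a (2 * a), c / ENNReal.ofReal t ≤ c := by
  rw [setLIntegral_congr Ico_ae_eq_Ioc]
  exact lintegral_Ioc_div_le ha c

/-- Pointwise estimate on a ball of the square function of a function vanishing on the double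
ball. -/
lemma gSq_far_le (hα : 0 < α) (hα1 : α ≤ 1) (hn : 0 < n) (hp : 1 < p)
    (hΦ : IsGrowthFunction Φ D) {f g : EuclideanSpace ℝ (Fin n) → 𝕜} (hf : LocallyIntegrable f)
    (hgf : ∀ z, ‖g z‖ₑ ≤ ‖f z‖ₑ) {C : ℝ≥0∞} (h : IsMorreyBound p Φ f C)
    {x₀ x : EuclideanSpace ℝ (Fin n)} {r : ℝ} (hr : 0 < r)
    (hg : ∀ z ∈ Metric.ball x₀ (2 * r), g z = 0) (hx : x ∈ Metric.ball x₀ r) :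
    gSq α g x ^ (p / 2) ≤ farSqConst n p D *
      (C ^ p * ENNReal.ofReal (Φ r) / ENNReal.ofReal r ^ n) := by
  have hp0 : 0 < p := by linarith
  set Z := C ^ p * ENNReal.ofReal (Φ r) / ENNReal.ofReal r ^ n with hZ
  set q := ENNReal.ofReal (D / 2 ^ n) with hq
  -- For t < r the ball of radius t about x stays inside the double ball, where g vanishes.
  have hnear : ∀ t ∈ Ioo 0 r, supConv α g x t ^ 2 / ENNReal.ofReal t = 0 := by
    intro t ht
    have h0 : ∫⁻ z in Metric.closedBall x t, ‖g z‖ₑ = 0 := by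
      rw [setLIntegral_congr_fun (g := fun _ => 0) Metric.isClosed_closedBall.measurableSet,
        lintegral_zero]
      intro z hz
      simp only
      rw [hg z, enorm_zero]
      rw [Metric.mem_closedBall] at hz
      rw [Metric.mem_ball] at hx ⊢
      linarith [dist_triangle z x x₀, ht.2]
    have := supConv_le_lintegral hα hα1 hn ht.1 g x
    rw [h0, mul_zero, nonpos_iff_eq_zero] at this
    simp [this]
  have hcover : Ioi (0 : ℝ) ⊆ Ioo 0 r ∪ ⋃ j : ℕ, Ico (2 ^ j * r) (2 * (2 ^ j * r)) := by
    intro t ht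
    rcases lt_or_ge t r with htr | htr
    · exact Or.inl ⟨ht, htr⟩
    · obtain ⟨j, hj1, hj2⟩ := exists_nat_pow_near (x := t / r) (y := 2)
        ((one_le_div hr).2 htr) one_lt_two
      refine Or.inr (mem_iUnion.2 ⟨j, (le_div_iff₀ hr).1 hj1, ?_⟩)
      rw [div_lt_iff₀ hr, pow_succ] at hj2
      linarith
  have hsum : gSq α g x ≤ farConst n p D ^ 2 * (1 - q ^ (2 / p))⁻¹ * Z ^ (2 / p) := by
    calc gSq α g x ≤ ∫⁻ t in Ioo 0 r ∪ ⋃ j : ℕ, Ico (2 ^ j * r) (2 * (2 ^ j * r)),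
          supConv α g x t ^ 2 / ENNReal.ofReal t := lintegral_mono_set hcover
      _ ≤ (∫⁻ t in Ioo 0 r, supConv α g x t ^ 2 / ENNReal.ofReal t) +
          ∫⁻ t in ⋃ j : ℕ, Ico (2 ^ j * r) (2 * (2 ^ j * r)),
            supConv α g x t ^ 2 / ENNReal.ofReal t := lintegral_union_le _ _ _
      _ = ∫⁻ t in ⋃ j : ℕ, Ico (2 ^ j * r) (2 * (2 ^ j * r)),
            supConv α g x t ^ 2 / ENNReal.ofReal t := by
          rw [setLIntegral_congr_fun measurableSet_Ioo hnear, lintegral_zero, zero_add]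
      _ ≤ ∑' j : ℕ, ∫⁻ t in Ico (2 ^ j * r) (2 * (2 ^ j * r)),
            supConv α g x t ^ 2 / ENNReal.ofReal t := lintegral_iUnion_le _ _
      _ ≤ ∑' j : ℕ, (farConst n p D * (q ^ j * Z) ^ (1 / p)) ^ 2 := by
          refine ENNReal.tsum_le_tsum fun j => ?_
          refine le_trans (setLIntegral_mono' measurableSet_Ico fun t ht => ?_)
            (lintegral_Ico_div_le (a := 2 ^ j * r) (by positivity) _)
          gcongr
          exact supConv_far_le hα hα1 hn hp hΦ hf hgf h hr hx j ht.1 ht.2.le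
      _ = ∑' j : ℕ, farConst n p D ^ 2 * ((q ^ (2 / p)) ^ j * Z ^ (2 / p)) := by
          refine tsum_congr fun j => ?_
          rw [mul_pow, ← ENNReal.rpow_mul_natCast, ENNReal.mul_rpow_of_nonneg _ _ (by positivity)]
          have e : 1 / p * ((2 : ℕ) : ℝ) = 2 / p := by push_cast; ring
          have e2 : (q ^ j) ^ (2 / p) = (q ^ (2 / p)) ^ j := by
            rw [← ENNReal.rpow_natCast q, ← ENNReal.rpow_natCast, ← ENNReal.rpow_mul,
              ← ENNReal.rpow_mul, mul_comm]
          rw [e, e2]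
      _ = _ := by
          rw [ENNReal.tsum_mul_left, ENNReal.tsum_mul_right, ENNReal.tsum_geometric]
          ring
  calc _ ≤ (farConst n p D ^ 2 * (1 - q ^ (2 / p))⁻¹ * Z ^ (2 / p)) ^ (p / 2) :=
        ENNReal.rpow_le_rpow hsum (by linarith)
    _ = _ := by
        rw [ENNReal.mul_rpow_of_nonneg _ _ (by linarith), ← ENNReal.rpow_mul, farSqConst]
        have e : 2 / p * (p / 2) = 1 := by field_simp
        rw [e, ENNReal.rpow_one]

end IntrinsicMorrey

/-! ### The Morrey estimate -/

namespace IntrinsicMorrey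

variable {n : ℕ} {α p D : ℝ} {Φ : ℝ → ℝ} {𝕜 : Type*} [RCLike 𝕜]

/-- The `p`-th power of the constant in the Morrey space estimate. -/
def morreyConst (n : ℕ) (α p D : ℝ) : ℝ≥0∞ :=
  ((2 : ℝ≥0∞) ^ 2) ^ (p / 2) * (2 ^ (p / 2) * (lpConst n α p * ENNReal.ofReal D +
    farSqConst n p D * volume (Metric.ball (0 : EuclideanSpace ℝ (Fin n)) 1)))

lemma morreyConst_ne_top (hα : 0 < α) (hp : 1 < p) (hD : D < 2 ^ n) : morreyConst n α p D ≠ ∞ := by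
  have hp0 : 0 ≤ p / 2 := by linarith
  exact ENNReal.mul_ne_top (ENNReal.rpow_ne_top_of_nonneg hp0 (by norm_num))
    (ENNReal.mul_ne_top (ENNReal.rpow_ne_top_of_nonneg hp0 (by norm_num))
      (ENNReal.add_ne_top.2 ⟨ENNReal.mul_ne_top (lpConst_ne_top hα hp) ENNReal.ofReal_ne_top,
        ENNReal.mul_ne_top (farSqConst_ne_top hp hD) measure_ball_lt_top.ne⟩))

/-- The near part uses the global L^p bound and one doubling of Φ. The far part is bounded pointwise
by a constant over r^n, and integration over the ball cancels r^n. -/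
lemma setLIntegral_gFun_le (hα : 0 < α) (hα1 : α ≤ 1) (hn : 0 < n) (hp : 1 < p)
    (hΦ : IsGrowthFunction Φ D) {f : EuclideanSpace ℝ (Fin n) → 𝕜} (hf : LocallyIntegrable f)
    {C : ℝ≥0∞} (hC : C ≠ ∞) (h : IsMorreyBound p Φ f C) (x₀ : EuclideanSpace ℝ (Fin n)) {r : ℝ}
    (hr : 0 < r) :
    ∫⁻ x in Metric.ball x₀ r, gFun α f x ^ p ≤
      morreyConst n α p D * (C ^ p * ENNReal.ofReal (Φ r)) := by
  have hp0 : 0 < p / 2 := by linarith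
  set B := Metric.ball x₀ (2 * r) with hB
  have hBm : MeasurableSet B := measurableSet_ball
  set M := C ^ p * ENNReal.ofReal (Φ r) with hM
  have hMt : M ≠ ∞ := ENNReal.mul_ne_top (ENNReal.rpow_ne_top_of_nonneg (by linarith) hC)
    ENNReal.ofReal_ne_top
  have hfB : ∫⁻ x in B, ‖f x‖ₑ ^ p ≤ ENNReal.ofReal D * M := by
    simpa using h.pow hΦ x₀ hr 1
  have hfBi : IntegrableOn f B := (hf.integrableOn_isCompact
    (isCompact_closedBall x₀ (2 * r))).mono_set Metric.ball_subset_closedBall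
  have h1i : Integrable (B.indicator f) := hfBi.integrable_indicator hBm
  have h1 : LocallyIntegrable (B.indicator f) := h1i.locallyIntegrable
  have h2 : LocallyIntegrable (Bᶜ.indicator f) := hf.indicator hBm.compl
  have h1p : ∫⁻ x, ‖B.indicator f x‖ₑ ^ p = ∫⁻ x in B, ‖f x‖ₑ ^ p := by
    rw [← lintegral_indicator hBm]
    refine lintegral_congr fun x => ?_
    by_cases hx : x ∈ B
    · rw [indicator_of_mem hx, indicator_of_mem hx]
    · rw [indicator_of_notMem hx, indicator_of_notMem hx, enorm_zero,
        ENNReal.zero_rpow_of_pos (by linarith)]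
  have hloc : ∀ b : Bool, LocallyIntegrable (cond b (B.indicator f) (Bᶜ.indicator f)) := by
    rintro (_ | _)
    exacts [h2, h1]
  have hsplit : ∀ x, gFun α f x ^ p ≤ ((2 : ℝ≥0∞) ^ 2) ^ (p / 2) * (2 ^ (p / 2) *
      (gSq α (B.indicator f) x ^ (p / 2) + gSq α (Bᶜ.indicator f) x ^ (p / 2))) := fun x => by
    rw [gFun_rpow]
    have := gSq_rpow_le_sum hα hα1 hn Finset.univ hloc (f := f) (x := x) (fun t ht => by
      rw [Fintype.sum_bool]
      have := supConv_add_le hα ht x h1 h2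
      rwa [indicator_self_add_compl] at this) hp0
    simpa using this
  have hnear : ∫⁻ x in Metric.ball x₀ r, gSq α (B.indicator f) x ^ (p / 2) ≤
      lpConst n α p * (ENNReal.ofReal D * M) := by
    calc _ ≤ ∫⁻ x, gSq α (B.indicator f) x ^ (p / 2) := setLIntegral_le_lintegral _ _
      _ ≤ lpConst n α p * ∫⁻ x, ‖B.indicator f x‖ₑ ^ p := by
        refine lintegral_gSq_rpow_le hα hα1 hn hp h1i ?_
        rw [h1p]
        exact hfB.trans_lt (ENNReal.mul_ne_top ENNReal.ofReal_ne_top hMt).lt_top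
      _ ≤ _ := by rw [h1p]; gcongr
  have hfar : ∫⁻ x in Metric.ball x₀ r, gSq α (Bᶜ.indicator f) x ^ (p / 2) ≤
      farSqConst n p D * volume (Metric.ball (0 : EuclideanSpace ℝ (Fin n)) 1) * M := by
    calc _ ≤ ∫⁻ _x in Metric.ball x₀ r, farSqConst n p D * (M / ENNReal.ofReal r ^ n) := by
          refine setLIntegral_mono' measurableSet_ball fun x hx => ?_
          refine gSq_far_le hα hα1 hn hp hΦ hf (fun z => ?_) h hr (fun z hz => ?_) hx
          · exact enorm_indicator_le_enorm_self f z
          · exact indicator_of_notMem (notMem_compl_iff.2 hz) f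
      _ = _ := by
          rw [setLIntegral_const, volume_ball_eq hn _ hr.le]
          have hR0 : ENNReal.ofReal r ^ n ≠ 0 := pow_ne_zero n (by simpa using hr)
          have hRt : ENNReal.ofReal r ^ n ≠ ∞ := ENNReal.pow_ne_top ENNReal.ofReal_ne_top
          calc _ = farSqConst n p D * volume (Metric.ball (0 : EuclideanSpace ℝ (Fin n)) 1) *
                (M / ENNReal.ofReal r ^ n * ENNReal.ofReal r ^ n) := by ring
            _ = _ := by rw [ENNReal.div_mul_cancel hR0 hRt]
  have hm1 := measurable_gSq hα hα1 hn h1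
  have hm2 := measurable_gSq hα hα1 hn h2
  calc _ ≤ ∫⁻ x in Metric.ball x₀ r, ((2 : ℝ≥0∞) ^ 2) ^ (p / 2) * (2 ^ (p / 2) *
        (gSq α (B.indicator f) x ^ (p / 2) + gSq α (Bᶜ.indicator f) x ^ (p / 2))) :=
        lintegral_mono hsplit
    _ = ((2 : ℝ≥0∞) ^ 2) ^ (p / 2) * (2 ^ (p / 2) *
        ((∫⁻ x in Metric.ball x₀ r, gSq α (B.indicator f) x ^ (p / 2)) +
          ∫⁻ x in Metric.ball x₀ r, gSq α (Bᶜ.indicator f) x ^ (p / 2))) := by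
        rw [lintegral_const_mul _ (by fun_prop), lintegral_const_mul _ (by fun_prop),
          lintegral_add_left (by fun_prop)]
    _ ≤ ((2 : ℝ≥0∞) ^ 2) ^ (p / 2) * (2 ^ (p / 2) *
        (lpConst n α p * (ENNReal.ofReal D * M) +
          farSqConst n p D * volume (Metric.ball (0 : EuclideanSpace ℝ (Fin n)) 1) * M)) := by
        gcongr
    _ = _ := by
        rw [morreyConst]
        ring

/-- A finite Morrey bound for a measurable function entails local integrability. -/
lemma IsMorreyBound.locallyIntegrable (hp : 1 < p) {g : EuclideanSpace ℝ (Fin n) → ℝ≥0∞}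
    (hg : Measurable g) {C : ℝ≥0∞} (hC : C ≠ ∞) (h : IsMorreyBound p Φ g C) :
    LocallyIntegrable g := by
  have hp0 : 0 < p := by linarith
  intro x
  refine ⟨Metric.ball x 1, Metric.ball_mem_nhds x one_pos, hg.aestronglyMeasurable, ?_⟩
  rw [hasFiniteIntegral_iff_enorm]
  refine (setLIntegral_le_rpow_mul (u := fun x => ‖g x‖ₑ) hg.enorm.aemeasurable hp).trans_lt ?_
  refine (ENNReal.mul_ne_top (ENNReal.rpow_ne_top_of_nonneg (by positivity)
    (ne_top_of_le_ne_top ?_ (h x 1 one_pos))) (ENNReal.rpow_ne_top_of_nonneg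
      (sub_nonneg.2 ((div_le_one hp0).2 hp.le)) measure_ball_lt_top.ne)).lt_top
  exact ENNReal.mul_ne_top (ENNReal.rpow_ne_top_of_nonneg hp0.le hC) ENNReal.ofReal_ne_top

lemma isMorreyBound_gFun (hα : 0 < α) (hα1 : α ≤ 1) (hn : 0 < n) (hp : 1 < p)
    (hΦ : IsGrowthFunction Φ D) {f : EuclideanSpace ℝ (Fin n) → 𝕜} (hf : LocallyIntegrable f)
    {C : ℝ≥0∞} (hC : C ≠ ∞) (h : IsMorreyBound p Φ f C) :
    IsMorreyBound p Φ (gFun α f) (morreyConst n α p D ^ (1 / p) * C) := by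
  have hp0 : 0 < p := by linarith
  intro x₀ r hr
  rw [ENNReal.mul_rpow_of_nonneg _ _ hp0.le, ← ENNReal.rpow_mul, one_div_mul_cancel hp0.ne',
    ENNReal.rpow_one, mul_assoc]
  simpa only [enorm_eq_self] using setLIntegral_gFun_le hα hα1 hn hp hΦ hf hC h x₀ hr

end IntrinsicMorrey

theorem corollary1p7 {𝕜 : Type*} [RCLike 𝕜] (n : ℕ) (α p D : ℝ) (Φ : ℝ → ℝ)
    (hα0 : 0 < α) (hα1 : α ≤ 1) (hp : 1 < p)
    (hΦ : IntrinsicMorrey.IsGrowthFunction Φ D) (hD : D < 2 ^ n) :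
    ∃ C : ℝ≥0, 0 < C ∧ ∀ f : EuclideanSpace ℝ (Fin n) → 𝕜,
      IntrinsicMorrey.MemMorrey p Φ f →
        IntrinsicMorrey.MemMorrey p Φ (IntrinsicMorrey.gFun α f) ∧
        IntrinsicMorrey.morreyNorm p Φ (IntrinsicMorrey.gFun α f) ≤
          C * IntrinsicMorrey.morreyNorm p Φ f := by
  open IntrinsicMorrey in
  -- In dimension 0 the conditions 1 ≤ D < 2^n are contradictory.
  have hn : 0 < n := by
    rcases Nat.eq_zero_or_pos n with rfl | hn
    · have := hΦ.one_le
      rw [pow_zero] at hD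
      linarith
    · exact hn
  have hK : morreyConst n α p D ^ (1 / p) ≠ ∞ :=
    ENNReal.rpow_ne_top_of_nonneg (by positivity) (morreyConst_ne_top hα0 hp hD)
  -- Adding 1 makes the constant positive, so that one may divide by it.
  refine ⟨(morreyConst n α p D ^ (1 / p)).toNNReal + 1, by positivity, fun f ⟨hf, hfin⟩ => ?_⟩
  have hle : morreyConst n α p D ^ (1 / p) ≤
      (((morreyConst n α p D ^ (1 / p)).toNNReal + 1 : ℝ≥0) : ℝ≥0∞) := by
    rw [ENNReal.coe_add, ENNReal.coe_toNNReal hK]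
    exact le_self_add
  have hbound : ∀ C, C ≠ ∞ → IsMorreyBound p Φ f C →
      morreyNorm p Φ (gFun α f) ≤
        (((morreyConst n α p D ^ (1 / p)).toNNReal + 1 : ℝ≥0) : ℝ≥0∞) * C := fun C hC h =>
    (sInf_le (isMorreyBound_gFun hα0 hα1 hn hp hΦ hf hC h)).trans (mul_le_mul' hle le_rfl)
  have hnorm : morreyNorm p Φ (gFun α f) ≤
      (((morreyConst n α p D ^ (1 / p)).toNNReal + 1 : ℝ≥0) : ℝ≥0∞) * morreyNorm p Φ f := by
    have hc0 : (((morreyConst n α p D ^ (1 / p)).toNNReal + 1 : ℝ≥0) : ℝ≥0∞) ≠ 0 := by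
      simp
    -- Dividing by the constant turns the goal into a lower bound for the infimum defining the norm
    -- of f, so each admissible bound can be treated separately.
    rw [mul_comm, ← ENNReal.div_le_iff_le_mul (Or.inl hc0) (Or.inl ENNReal.coe_ne_top)]
    refine le_sInf fun C h => ?_
    rcases eq_or_ne C ∞ with rfl | hC
    · exact le_top
    · rw [ENNReal.div_le_iff_le_mul (Or.inl hc0) (Or.inl ENNReal.coe_ne_top), mul_comm]
      exact hbound C hC h
  -- Any finite admissible bound for f suffices for the local integrability of the square function.
  obtain ⟨C, h, hC⟩ := sInf_lt_iff.1 hfin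
  exact ⟨⟨(isMorreyBound_gFun hα0 hα1 hn hp hΦ hf hC.ne h).locallyIntegrable hp
    (measurable_gFun hα0 hα1 hn hf) (ENNReal.mul_ne_top hK hC.ne),
    hnorm.trans_lt (ENNReal.mul_lt_top ENNReal.coe_lt_top hfin)⟩, hnorm⟩
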